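/- Let $G$ be a finite simple graph. Write $\tau(G)$ for the minimum size of a set $Y$ of edges of $G$ such that $G-Y$ is triangle-free, $\nu(G)$ for the maximum size of a set of pairwise edge-disjoint triangles in $G$, and $$\operatorname{mad}(G)=\max\left\{\frac{2|E(H)|}{|V(H)|} : H\subseteq G,\ V(H)\neq\emptyset\right\}$$ for the maximum average degree of $G$ (with $\operatorname{mad}(G)=0$ if $G$ has no vertices). If $\operatorname{mad}(G)<7$, then $\tau(G)\le 2\nu(G)$. -/

import Mathlib

namespace SimpleGraph

/-- The maximum average degree of a finite graph `G`: the maximum of `2|E(H)| / |V(H)|` over all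
subgraphs `H` of `G` with at least one vertex (it is `0` for the graph without vertices). -/
noncomputable def mad {V : Type*} (G : SimpleGraph V) : ℝ :=
  sSup {d : ℝ | ∃ H : G.Subgraph, H.verts.Nonempty ∧
    d = 2 * (H.edgeSet.ncard : ℝ) / (H.verts.ncard : ℝ)}

/-- A set of pairwise edge-disjoint triangles of `G`, a triangle being given by its vertex set:
two distinct members have at most one common vertex, that is, no common edge. -/
def IsTrianglePacking {V : Type*} (G : SimpleGraph V) (T : Finset (Finset V)) : Prop :=
  (∀ t ∈ T, G.IsNClique 3 t) ∧
    (T : Set (Finset V)).Pairwise fun s t => ((s : Set V) ∩ (t : Set V)).Subsingleton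

/-- A set of edges of `G` whose deletion leaves a triangle-free graph. -/
def IsTriangleCover {V : Type*} (G : SimpleGraph V) (Y : Finset (Sym2 V)) : Prop :=
  (Y : Set (Sym2 V)) ⊆ G.edgeSet ∧ (G.deleteEdges (Y : Set (Sym2 V))).CliqueFree 3

/-- `ν(G)`: the maximum size of a set of edge-disjoint triangles of the finite graph `G`. -/
noncomputable def trianglePackingNumber {V : Type*} (G : SimpleGraph V) : ℕ :=
  sSup {n : ℕ | ∃ T : Finset (Finset V), G.IsTrianglePacking T ∧ T.card = n}

/-- `τ(G)`: the minimum size of a set of edges of the finite graph `G` whose deletion leaves a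
triangle-free graph. -/
noncomputable def triangleCoverNumber {V : Type*} (G : SimpleGraph V) : ℕ :=
  sInf {n : ℕ | ∃ Y : Finset (Sym2 V), G.IsTriangleCover Y ∧ Y.card = n}

end SimpleGraph

/-! The proof is an induction on the number of edges. A reduction of `G` is a nonempty set `T` of
edge-disjoint triangles with a set `Y` of at most `2|T|` edges such that no triangle of `G - Y`
shares an edge with a member of `T`. Given one, an optimal-enough pair for `G - Y` extends by `T`
and `Y`, and the inequality `|cover| ≤ 2 |packing|` is preserved. An edge in no triangle can simply
be dropped. What remains is a tight graph (no reduction, every edge in a triangle), and the point is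
that the non-isolated vertices of a tight graph have average degree at least seven, so a sparse
tight graph has no edges.

Average degree seven is proved by discharging. Non-isolated vertices have degree at least five; call
those of degree five or six low. The structural facts are these: low vertices are pairwise
non-adjacent (`seven_le_degree_of_adj`); a degree-six vertex has no neighbour of degree seven
(`degree_ne_seven_of_adj`); a degree-five vertex with a neighbour of degree seven has three
neighbours with charge to spare (`exists_three_of_adj_five_seven`); a vertex of degree eight has at
most two neighbours of degree five (`false_of_degree_eq_eight`). Also, by Hall's theorem, fewer than
half of the neighbours of a vertex are low (`card_lt_of_independent`).

Most local configurations are excluded by certificates. A partially known graph on a few vertices is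
split by case distinctions on single adjacencies, each leaf naming an explicit reduction or a
contradiction. A Boolean checker validates the certificate by kernel computation, and
`not_refutedBy` is its soundness. Near-cliques (neighbourhoods whose complement is a matching),
which surround every low vertex, keep the configurations few. -/

namespace SimpleGraph

/-! ### Reductions, and a verified checker for local configurations -/

variable {V : Type*} {G : SimpleGraph V}

/-- No nonempty packing `T` can be removed at the expense of `2 * T.card` edges: whenever so few
edges are deleted, a surviving triangle shares an edge with a member of `T`. -/
def IsTuzaIrreducible (G : SimpleGraph V) : Prop :=
  ∀ (T : Finset (Finset V)) (Y : Finset (Sym2 V)), T.Nonempty → G.IsTrianglePacking T →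
    Y.card ≤ 2 * T.card →
    ∃ t ∈ T, ∃ s, (G.deleteEdges (Y : Set (Sym2 V))).IsNClique 3 s ∧
      ¬ ((s : Set V) ∩ (t : Set V)).Subsingleton

/-- An irreducible graph in which every edge lies in a triangle. -/
structure IsTuzaTight (G : SimpleGraph V) : Prop where
  irreducible : G.IsTuzaIrreducible
  exists_common : ∀ a b, G.Adj a b → ∃ c, G.Adj a c ∧ G.Adj b c

/-- In the neighbourhood of `v` each vertex has at most one non-neighbour. -/
def IsNearClique (G : SimpleGraph V) (v : V) : Prop :=
  ∀ a b c, G.Adj v a → G.Adj v b → G.Adj v c → a ≠ b → a ≠ c → b ≠ c → G.Adj a b ∨ G.Adj a c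

/-- Partial information on the adjacency of `n` distinct vertices of a graph: the complete
neighbourhoods of some of them, those whose neighbourhood is known to be a near-clique,
and some adjacent and nonadjacent pairs. -/
structure Pattern (n : ℕ) where
  nbrs : List (Fin n × List (Fin n))
  near : List (Fin n)
  pos : List (Fin n × Fin n)
  neg : List (Fin n × Fin n)

namespace Pattern

variable {n : ℕ}

/-- `adj` and `nonadj` hold only when the pattern forces the answer; for an undetermined pair both
are false, and such pairs are what case trees branch on. -/
def adj (p : Pattern n) (i j : Fin n) : Bool :=
  (p.nbrs.any fun e => (e.1 == i && e.2.contains j) || (e.1 == j && e.2.contains i)) ||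
    p.pos.contains (i, j) || p.pos.contains (j, i)

def nonadj (p : Pattern n) (i j : Fin n) : Bool :=
  (p.nbrs.any fun e => (e.1 == i && !e.2.contains j) || (e.1 == j && !e.2.contains i)) ||
    p.neg.contains (i, j) || p.neg.contains (j, i)

structure Realizes (p : Pattern n) (G : SimpleGraph V) (f : Fin n → V) : Prop where
  inj : Function.Injective f
  nbrs : p.nbrs.Forall fun e => ∀ w, G.Adj (f e.1) w ↔ w ∈ e.2.map f
  near : p.near.Forall fun i => G.IsNearClique (f i)
  pos : p.pos.Forall fun e => G.Adj (f e.1) (f e.2)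
  neg : p.neg.Forall fun e => ¬ G.Adj (f e.1) (f e.2)

variable {p : Pattern n} {f : Fin n → V}

lemma Realizes.adj (h : p.Realizes G f) {i j : Fin n} (hij : p.adj i j = true) :
    G.Adj (f i) (f j) := by
  have hn := List.forall_iff_forall_mem.1 h.nbrs
  have hp := List.forall_iff_forall_mem.1 h.pos
  simp only [Pattern.adj, Bool.or_eq_true, List.any_eq_true, Bool.and_eq_true, beq_iff_eq,
    List.contains_iff_mem] at hij
  rcases hij with (⟨e, he, ⟨rfl, hj⟩ | ⟨rfl, hj⟩⟩ | hij) | hij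
  · exact (hn e he _).2 (List.mem_map_of_mem hj)
  · exact ((hn e he _).2 (List.mem_map_of_mem hj)).symm
  · exact hp _ hij
  · exact (hp _ hij).symm

lemma Realizes.nonadj (h : p.Realizes G f) {i j : Fin n} (hij : p.nonadj i j = true) :
    ¬ G.Adj (f i) (f j) := by
  have hn := List.forall_iff_forall_mem.1 h.nbrs
  have hp := List.forall_iff_forall_mem.1 h.neg
  have key : ∀ e ∈ p.nbrs, ∀ k, k ∉ e.2 → ¬ G.Adj (f e.1) (f k) := by
    intro e he k hk hadj
    obtain ⟨k', hk', hkk⟩ := List.mem_map.1 ((hn e he _).1 hadj)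
    exact hk (h.inj hkk ▸ hk')
  simp only [Pattern.nonadj, Bool.or_eq_true, List.any_eq_true, Bool.and_eq_true, beq_iff_eq,
    List.contains_iff_mem, Bool.not_eq_true', ← Bool.not_eq_true] at hij
  rcases hij with (⟨e, he, ⟨rfl, hj⟩ | ⟨rfl, hj⟩⟩ | hij) | hij
  · exact key e he _ hj
  · exact fun hadj => key e he _ hj hadj.symm
  · exact hp _ hij
  · exact fun hadj => hp _ hij hadj.symm

def cut (X : List (Fin n × Fin n)) (i j : Fin n) : Bool := X.contains (i, j) || X.contains (j, i)

def triangleEdges (t : Fin n × Fin n × Fin n) : List (Fin n × Fin n) :=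
  [(t.1, t.2.1), (t.1, t.2.2), (t.2.1, t.2.2)]

/-- After deletion of `X`, the edge `e` lies in no triangle. -/
def dead (p : Pattern n) (X : List (Fin n × Fin n)) (e : Fin n × Fin n) : Bool :=
  p.nbrs.any fun m => (m.1 == e.1 || m.1 == e.2) && m.2.all fun k =>
    k == e.1 || k == e.2 || p.nonadj e.1 k || p.nonadj e.2 k || cut X e.1 k || cut X e.2 k

/-- Packing the triangles `S` and deleting the edges `X` is a reduction. -/
def reducesBy (p : Pattern n) (S : List (Fin n × Fin n × Fin n)) (X : List (Fin n × Fin n)) :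
    Bool :=
  !S.isEmpty && decide (X.length ≤ 2 * S.length) &&
  (S.all fun t => decide (t.1 < t.2.1) && decide (t.2.1 < t.2.2) && p.adj t.1 t.2.1 &&
    p.adj t.1 t.2.2 && p.adj t.2.1 t.2.2) &&
  decide (S.flatMap triangleEdges).Nodup &&
  ((S.flatMap triangleEdges).all fun e => cut X e.1 e.2 || p.dead X e)

/-- The pattern has an edge in no triangle, or violates a near-clique condition. -/
def contradicts (p : Pattern n) : Bool :=
  p.nbrs.any fun m =>
    (m.2.any fun i => m.2.all fun j => i == j || p.nonadj i j) ||
    (p.near.contains m.1 && m.2.any fun i => m.2.any fun j => i != j && p.nonadj i j &&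
      m.2.any fun k => i != k && j != k && p.nonadj i k)

/-- A case distinction on adjacencies, with a reduction or a contradiction in each case. -/
inductive CaseTree (n : ℕ)
  | absurd : CaseTree n
  | leaf (S : List (Fin n × Fin n × Fin n)) (X : List (Fin n × Fin n)) : CaseTree n
  | branch (i j : Fin n) (yes no : CaseTree n) : CaseTree n

def refutedBy (p : Pattern n) : CaseTree n → Bool
  | .absurd => p.contradicts
  | .leaf S X => p.reducesBy S X
  | .branch i j yes no =>
    refutedBy { p with pos := (i, j) :: p.pos } yes &&
      refutedBy { p with neg := (i, j) :: p.neg } no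

/-- Increasing triples give every edge a unique representative, so that `Nodup` of the concatenated
edge lists expresses edge-disjointness. -/
lemma mem_triangleEdges {t : Fin n × Fin n × Fin n} (h₁ : t.1 < t.2.1) (h₂ : t.2.1 < t.2.2)
    {i j : Fin n} (hij : i < j) (hi : i = t.1 ∨ i = t.2.1 ∨ i = t.2.2)
    (hj : j = t.1 ∨ j = t.2.1 ∨ j = t.2.2) : (i, j) ∈ triangleEdges t := by
  obtain ⟨a, b, c⟩ := t
  simp only [triangleEdges, List.mem_cons, Prod.mk.injEq, List.not_mem_nil] at *
  omega

lemma exists_lt_of_not_subsingleton {t : Fin n × Fin n × Fin n} {s A : Set V}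
    (hA : ∀ w ∈ A, w = f t.1 ∨ w = f t.2.1 ∨ w = f t.2.2)
    (h : ¬ (s ∩ A).Subsingleton) :
    ∃ i j, i < j ∧ (i = t.1 ∨ i = t.2.1 ∨ i = t.2.2) ∧ (j = t.1 ∨ j = t.2.1 ∨ j = t.2.2) ∧
      f i ∈ s ∩ A ∧ f j ∈ s ∩ A := by
  have key : ∀ w ∈ A, ∃ i, (i = t.1 ∨ i = t.2.1 ∨ i = t.2.2) ∧ f i = w := by
    intro w hw
    rcases hA w hw with rfl | rfl | rfl <;> exact ⟨_, by simp, rfl⟩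
  rw [Set.not_subsingleton_iff] at h
  obtain ⟨x, hx, y, hy, hxy⟩ := h
  obtain ⟨i, hi, rfl⟩ := key x hx.2
  obtain ⟨j, hj, rfl⟩ := key y hy.2
  rcases lt_trichotomy i j with hij | rfl | hij
  · exact ⟨i, j, hij, hi, hj, hx, hy⟩
  · exact absurd rfl hxy
  · exact ⟨j, i, hij, hj, hi, hy, hx⟩

/-- Soundness of a leaf. If a triangle survived the deletion and shared an edge with a packed one,
that edge would be neither cut nor dead: a dead edge has an endpoint with fully listed
neighbourhood, and every candidate third vertex in the list is ruled out. -/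
lemma Realizes.not_reducesBy (h : p.Realizes G f) (hG : G.IsTuzaIrreducible)
    {S : List (Fin n × Fin n × Fin n)} {X : List (Fin n × Fin n)} : ¬ p.reducesBy S X := by
  classical
  intro hred
  simp only [reducesBy, Bool.and_eq_true, decide_eq_true_eq, List.all_eq_true, Bool.or_eq_true,
    Bool.not_eq_true', List.isEmpty_eq_false_iff] at hred
  obtain ⟨⟨⟨⟨hS, hX⟩, htri⟩, hnd⟩, hcut⟩ := hred
  let tri : Fin n × Fin n × Fin n → Finset V := fun t => {f t.1, f t.2.1, f t.2.2}
  have htri_mem : ∀ t, ∀ w ∈ (tri t : Set V), w = f t.1 ∨ w = f t.2.1 ∨ w = f t.2.2 := by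
    intro t w hw
    simpa [tri] using hw
  have mem_tri : ∀ t i, f i ∈ (tri t : Set V) → (i = t.1 ∨ i = t.2.1 ∨ i = t.2.2) := by
    intro t i hi
    rcases htri_mem t _ hi with hi | hi | hi <;> simp [h.inj hi]
  have hclique : ∀ t ∈ S, G.IsNClique 3 (tri t) := by
    intro t ht
    obtain ⟨⟨⟨⟨-, -⟩, h1⟩, h2⟩, h3⟩ := htri t ht
    exact is3Clique_iff.2 ⟨_, _, _, h.adj h1, h.adj h2, h.adj h3, rfl⟩
  rw [List.nodup_flatMap] at hnd
  have hpair : S.Pairwise fun t₁ t₂ =>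
      ((tri t₁ : Set V) ∩ (tri t₂ : Set V)).Subsingleton := by
    refine List.Pairwise.imp_of_mem ?_ hnd.2
    intro t₁ t₂ ht₁ ht₂ hdisj
    by_contra hns
    obtain ⟨i, j, hij, hi, hj, hi', hj'⟩ := exists_lt_of_not_subsingleton (htri_mem t₂) hns
    obtain ⟨⟨⟨⟨a1, a2⟩, -⟩, -⟩, -⟩ := htri t₁ ht₁
    obtain ⟨⟨⟨⟨b1, b2⟩, -⟩, -⟩, -⟩ := htri t₂ ht₂
    exact hdisj (mem_triangleEdges a1 a2 hij (mem_tri _ _ hi'.1) (mem_tri _ _ hj'.1))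
      (mem_triangleEdges b1 b2 hij hi hj)
  have hmapnd : (S.map tri).Nodup := by
    rw [List.Nodup, List.pairwise_map]
    refine List.Pairwise.imp_of_mem ?_ hpair
    intro t₁ t₂ ht₁ _ hsub heq
    rw [← heq, Set.inter_self] at hsub
    have := Finset.card_le_one_iff_subsingleton_coe.2 (Set.subsingleton_coe _ |>.2 hsub)
    have := (hclique t₁ ht₁).card_eq
    omega
  let T : Finset (Finset V) := (S.map tri).toFinset
  let Y : Finset (Sym2 V) := (X.map fun e => s(f e.1, f e.2)).toFinset
  have hTcard : T.card = S.length := by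
    simp [T, List.toFinset_card_of_nodup hmapnd]
  have hYcard : Y.card ≤ X.length := by
    simpa using (X.map fun e => s(f e.1, f e.2)).toFinset_card_le
  have hcutY : ∀ i j, cut X i j = true → s(f i, f j) ∈ Y := by
    intro i j hij
    simp only [cut, Bool.or_eq_true, List.contains_iff_mem] at hij
    simp only [Y, List.mem_toFinset, List.mem_map]
    rcases hij with hij | hij
    · exact ⟨_, hij, rfl⟩
    · exact ⟨_, hij, Sym2.eq_swap⟩
  have hTne : T.Nonempty := by
    rw [← Finset.card_pos, hTcard]
    exact List.length_pos_iff.2 hS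
  have hpack : G.IsTrianglePacking T := by
    refine ⟨fun t ht => ?_, ?_⟩
    · obtain ⟨t', ht', rfl⟩ := List.mem_map.1 (List.mem_toFinset.1 ht)
      exact hclique t' ht'
    · have hp : (S.map tri).Pairwise fun (s t : Finset V) => ((s : Set V) ∩ (t : Set V)).Subsingleton :=
        List.pairwise_map.2 hpair
      have : Std.Symm fun s t : Finset V => ((s : Set V) ∩ (t : Set V)).Subsingleton :=
        ⟨fun s t hst => by rwa [Set.inter_comm]⟩
      intro s hs t ht hst
      exact hp.forall (List.mem_toFinset.1 hs) (List.mem_toFinset.1 ht) hst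
  obtain ⟨t', ht', s, hs, hns⟩ := hG T Y hTne hpack (by omega)
  obtain ⟨t, ht, rfl⟩ := List.mem_map.1 (List.mem_toFinset.1 ht')
  obtain ⟨i, j, hij, hi, hj, hi', hj'⟩ := exists_lt_of_not_subsingleton (htri_mem t) hns
  obtain ⟨⟨⟨⟨a1, a2⟩, -⟩, -⟩, -⟩ := htri t ht
  have hmem := hcut (i, j) (List.mem_flatMap.2 ⟨t, ht, mem_triangleEdges a1 a2 hij hi hj⟩)
  have hdel : ∀ x y, (G.deleteEdges (Y : Set (Sym2 V))).Adj x y → G.Adj x y ∧ s(x, y) ∉ Y := by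
    intro x y hxy
    simpa [deleteEdges_adj] using hxy
  have hne : f i ≠ f j := fun he => hij.ne (h.inj he)
  have hadjs : ∀ x ∈ s, ∀ y ∈ s, x ≠ y → G.Adj x y ∧ s(x, y) ∉ Y :=
    fun x hx y hy hxy => hdel x y (hs.isClique hx hy hxy)
  rcases hmem with hmem | hmem
  · exact (hadjs _ hi'.1 _ hj'.1 hne).2 (hcutY _ _ hmem)
  -- The third vertex of the surviving triangle; it must occur in the complete list that witnesses
  -- `dead`.
  · obtain ⟨w, hw, hwi, hwj⟩ : ∃ w ∈ s, w ≠ f i ∧ w ≠ f j := by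
      by_contra hcon
      push Not at hcon
      have hsub : s ⊆ {f i, f j} := by
        intro w hw
        by_cases hwi : w = f i
        · simp [hwi]
        · simp [hcon w hw hwi]
      have := Finset.card_le_card hsub
      have := hs.card_eq
      have := Finset.card_le_two (a := f i) (b := f j)
      omega
    have hiw := hadjs _ hi'.1 _ hw hwi.symm
    have hjw := hadjs _ hj'.1 _ hw hwj.symm
    simp only [dead, List.any_eq_true, Bool.and_eq_true, Bool.or_eq_true, beq_iff_eq,
      List.all_eq_true] at hmem
    obtain ⟨m, hm, hmij, hall⟩ := hmem
    have hwm : G.Adj (f m.1) w := by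
      rcases hmij with hmi | hmj
      · rw [hmi]; exact hiw.1
      · rw [hmj]; exact hjw.1
    obtain ⟨k, hk, rfl⟩ :=
      List.mem_map.1 ((List.forall_iff_forall_mem.1 h.nbrs m hm w).1 hwm)
    rcases hall k hk with ((((hk | hk) | hk) | hk) | hk) | hk
    · exact hwi (by rw [hk])
    · exact hwj (by rw [hk])
    · exact h.nonadj hk hiw.1
    · exact h.nonadj hk hjw.1
    · exact hiw.2 (hcutY _ _ hk)
    · exact hjw.2 (hcutY _ _ hk)

lemma Realizes.not_contradicts (h : p.Realizes G f)
    (hG : ∀ a b, G.Adj a b → ∃ c, G.Adj a c ∧ G.Adj b c) : ¬ p.contradicts := by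
  intro hc
  have hn := List.forall_iff_forall_mem.1 h.nbrs
  simp only [contradicts, List.any_eq_true, Bool.or_eq_true, List.all_eq_true, Bool.and_eq_true,
    beq_iff_eq, List.contains_iff_mem, bne_iff_ne] at hc
  obtain ⟨m, hm, ⟨i, hi, hall⟩ | ⟨hnear, i, hi, j, hj, ⟨hij, hij'⟩, k, hk, ⟨hik, hjk⟩, hik'⟩⟩ := hc
  · obtain ⟨c, hc, hic⟩ := hG _ _ ((hn m hm (f i)).2 (List.mem_map_of_mem hi))
    obtain ⟨j, hj, rfl⟩ := List.mem_map.1 ((hn m hm c).1 hc)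
    rcases hall j hj with rfl | hij
    · exact hic.ne rfl
    · exact h.nonadj hij hic
  · have adj : ∀ {x}, x ∈ m.2 → G.Adj (f m.1) (f x) :=
      fun hx => (hn m hm _).2 (List.mem_map_of_mem hx)
    rcases List.forall_iff_forall_mem.1 h.near m.1 hnear (f i) (f j) (f k) (adj hi) (adj hj)
      (adj hk) (h.inj.ne hij) (h.inj.ne hik) (h.inj.ne hjk) with h' | h'
    · exact h.nonadj hij' h'
    · exact h.nonadj hik' h'

theorem Realizes.not_refutedBy (h : p.Realizes G f) (hG : G.IsTuzaTight) (t : CaseTree n) :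
    ¬ p.refutedBy t := by
  induction t generalizing p with
  | absurd => exact h.not_contradicts hG.exists_common
  | leaf S X => exact h.not_reducesBy hG.irreducible
  | branch i j yes no hyes hno =>
    simp only [refutedBy, Bool.and_eq_true, not_and]
    intro h1 h2
    by_cases hij : G.Adj (f i) (f j)
    · have pos := (List.forall_cons (fun e : Fin n × Fin n => G.Adj (f e.1) (f e.2)) (i, j)
        p.pos).2 ⟨hij, h.pos⟩
      exact hyes (p := { p with pos := (i, j) :: p.pos }) ⟨h.inj, h.nbrs, h.near, pos, h.neg⟩ h1
    · have neg := (List.forall_cons (fun e : Fin n × Fin n => ¬ G.Adj (f e.1) (f e.2)) (i, j)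
        p.neg).2 ⟨hij, h.neg⟩
      exact hno (p := { p with neg := (i, j) :: p.neg }) ⟨h.inj, h.nbrs, h.near, h.pos, neg⟩ h2

end Pattern

/-- A pattern refuted by a case tree does not occur in a tight graph. -/
theorem IsTuzaTight.false_of_refutedBy (hG : G.IsTuzaTight) {n : ℕ} (p : Pattern n)
    (f : Fin n → V) (t : Pattern.CaseTree n) (ht : p.refutedBy t = true)
    (hf : (List.ofFn f).Nodup)
    (nbrs : p.nbrs.Forall fun e => ∀ w, G.Adj (f e.1) w ↔ w ∈ e.2.map f)
    (near : p.near.Forall fun i => G.IsNearClique (f i))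
    (pos : p.pos.Forall fun e => G.Adj (f e.1) (f e.2))
    (neg : p.neg.Forall fun e => ¬ G.Adj (f e.1) (f e.2)) : False :=
  Pattern.Realizes.not_refutedBy ⟨List.nodup_ofFn.1 hf, nbrs, near, pos, neg⟩ hG t ht

end SimpleGraph

/-! ### Independent sets in a neighbourhood, via Hall's theorem -/

namespace SimpleGraph

variable {V : Type*} {G : SimpleGraph V}

/-- In a tight graph, an independent set `I` of neighbours of `v` is smaller than its
neighbourhood within the neighbourhood of `v`. -/
theorem IsTuzaTight.card_lt_of_independent [Fintype V] [DecidableEq V] [DecidableRel G.Adj]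
    (hG : G.IsTuzaTight) (v : V) (I : Finset V) (hne : I.Nonempty)
    (hI : ∀ a ∈ I, G.Adj v a) (hind : ∀ a ∈ I, ∀ b ∈ I, ¬ G.Adj a b) :
    I.card < (I.biUnion fun a => G.neighborFinset v ∩ G.neighborFinset a).card := by
  induction I using Finset.strongInduction with
  | H I ih =>
    -- Proper nonempty subsets of `I` already satisfy the strict inequality, so `I` is a minimal
    -- violator.
    by_contra hle
    rw [not_lt] at hle
    set t : V → Finset V := fun a => G.neighborFinset v ∩ G.neighborFinset a with ht
    have hmem : ∀ {a w}, w ∈ t a ↔ G.Adj v w ∧ G.Adj a w := by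
      intro a w; simp [ht]
    have hsub : ∀ J ⊂ I, J.Nonempty → J.card < (J.biUnion t).card := fun J hJ hJne =>
      ih J hJ hJne (fun a ha => hI a (hJ.1 ha)) fun a ha b hb => hind a (hJ.1 ha) b (hJ.1 hb)
    -- Removing one element costs at most one on the left, where the inequality was strict. So
    -- Hall's condition holds for `I` itself, and `I` can be matched into its neighbourhood in
    -- `N(v)`. A singleton is covered because the edge `va` lies in a triangle.
    have hfull : I.card ≤ (I.biUnion t).card := by
      obtain ⟨a, ha⟩ := hne
      by_cases hJ : (I.erase a).Nonempty
      · have h1 := hsub _ (Finset.erase_ssubset ha) hJ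
        have h2 := Finset.card_le_card (Finset.biUnion_subset_biUnion_of_subset_left t
          (Finset.erase_subset a I))
        have h3 := Finset.card_erase_add_one ha
        omega
      · have h3 := Finset.card_erase_add_one ha
        rw [Finset.not_nonempty_iff_eq_empty.1 hJ, Finset.card_empty] at h3
        obtain ⟨c, hc, hc'⟩ := hG.exists_common v a (hI a ha)
        have : 0 < (I.biUnion t).card :=
          Finset.card_pos.2 ⟨c, Finset.mem_biUnion.2 ⟨a, ha, hmem.2 ⟨hc, hc'⟩⟩⟩
        omega
    have hhall : ∀ s : Finset I, s.card ≤ (s.biUnion fun a => t a).card := by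
      intro s
      have hs : (s.map (Function.Embedding.subtype _)).biUnion t = s.biUnion fun a => t a := by
        rw [Finset.map_eq_image, Finset.image_biUnion]; rfl
      rw [← hs, ← Finset.card_map (Function.Embedding.subtype _)]
      have hsI : s.map (Function.Embedding.subtype _) ⊆ I := by
        intro x hx
        obtain ⟨y, -, rfl⟩ := Finset.mem_map.1 hx
        exact y.2
      rcases hsI.eq_or_ssubset with h | h
      · rw [h]; exact hfull
      · rcases (s.map (Function.Embedding.subtype _)).eq_empty_or_nonempty with h0 | h0
        · simp [h0]
        · exact (hsub _ h h0).le
    obtain ⟨g, hginj, hg⟩ := (Finset.all_card_le_biUnion_card_iff_exists_injective _).1 hhall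
    have hgv : ∀ a, G.Adj v (g a) := fun a => (hmem.1 (hg a)).1
    have hga : ∀ a : I, G.Adj a (g a) := fun a => (hmem.1 (hg a)).2
    have hva : ∀ a : I, G.Adj v a := fun a => hI a a.2
    have hgI : ∀ a b : I, (b : V) ≠ g a := fun a b hab =>
      hind a a.2 b b.2 (hab ▸ hga a)
    let tri : I → Finset V := fun a => {v, (a : V), g a}
    have htri : ∀ a, ∀ w, w ∈ tri a ↔ w = v ∨ w = a ∨ w = g a := by
      intro a w; simp [tri]
    have hinj : Function.Injective tri := by
      intro a b hab
      have : (a : V) ∈ tri b := hab ▸ (htri a a).2 (by simp)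
      rcases (htri b a).1 this with h | h | h
      · exact absurd h (hva a).ne'
      · exact Subtype.ext h
      · exact absurd h (hgI b a)
    let T := Finset.univ.image tri
    -- The matching edges and all edges from `v` to `N(I)`: at most `|I| + |N(I)| ≤ 2|I|`, as `I`
    -- violates the inequality. The packed triangles are `v, a, g a`.
    let Y := (Finset.univ.image fun a : I => s((a : V), g a)) ∪
      (I.biUnion t).image fun w => s(v, w)
    have hT : T.card = I.card := by
      simp [T, Finset.card_image_of_injective _ hinj]
    have hY : Y.card ≤ 2 * I.card := by
      have h1 := Finset.card_union_le (Finset.univ.image fun a : I => s((a : V), g a))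
        ((I.biUnion t).image fun w => s(v, w))
      have h2 := Finset.card_image_le (s := Finset.univ) (f := fun a : I => s((a : V), g a))
      have h3 := Finset.card_image_le (s := I.biUnion t) (f := fun w => s(v, w))
      simp only [Finset.card_univ, Fintype.card_coe] at h2
      have h4 : Y.card ≤ _ := h1
      omega
    have hpack : G.IsTrianglePacking T := by
      constructor
      · intro s hs
        obtain ⟨a, -, rfl⟩ := Finset.mem_image.1 hs
        exact is3Clique_iff.2 ⟨_, _, _, hva a, hgv a, hga a, rfl⟩
      · intro s hs s' hs' hne
        obtain ⟨a, -, rfl⟩ := Finset.mem_image.1 hs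
        obtain ⟨b, -, rfl⟩ := Finset.mem_image.1 hs'
        have hab : a ≠ b := fun h => hne (by rw [h])
        have : ∀ x ∈ (tri a : Set V) ∩ (tri b : Set V), x = v := by
          rintro x ⟨hx, hx'⟩
          rcases (htri a x).1 hx with h | h | h
          · exact h
          · rcases (htri b x).1 hx' with h' | h' | h'
            · exact h'
            · exact absurd (Subtype.ext (h ▸ h')) hab
            · exact absurd (h ▸ h') (hgI b a)
          · rcases (htri b x).1 hx' with h' | h' | h'
            · exact h'
            · exact absurd (h' ▸ h) (hgI a b)
            · exact absurd (hginj (h ▸ h')) hab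
        exact fun x hx y hy => (this x hx).trans (this y hy).symm
    have hYv : ∀ a ∈ I, ∀ w, G.Adj v w → G.Adj a w → s(v, w) ∈ Y := fun a ha w hv ha' =>
      Finset.mem_union_right _ (Finset.mem_image_of_mem _
        (Finset.mem_biUnion.2 ⟨a, ha, hmem.2 ⟨hv, ha'⟩⟩))
    have hYg : ∀ a : I, s((a : V), g a) ∈ Y := fun a =>
      Finset.mem_union_left _ (Finset.mem_image_of_mem _ (Finset.mem_univ a))
    obtain ⟨s, hs, c, hc, hns⟩ := hG.irreducible T Y
      (Finset.card_pos.1 (by rw [hT]; exact Finset.card_pos.2 hne)) hpack (by rw [hT]; exact hY)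
    obtain ⟨a, -, rfl⟩ := Finset.mem_image.1 hs
    have hadj : ∀ x ∈ c, ∀ y ∈ c, x ≠ y → G.Adj x y ∧ s(x, y) ∉ Y := by
      intro x hx y hy hxy
      have := hc.isClique hx hy hxy
      simpa [deleteEdges_adj] using this
    -- The edge `va` is not deleted, but the third vertex `w` of a triangle on it lies in `N(I)`, so
    -- `vw` is.
    have hav : v ∉ c ∨ (a : V) ∉ c := by
      by_contra! hcon
      obtain ⟨w, hw, hwv, hwa⟩ : ∃ w ∈ c, w ≠ v ∧ w ≠ a := by
        by_contra! hcon'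
        have hcsub : c ⊆ {v, (a : V)} := by
          intro w hw
          by_cases hwv : w = v
          · simp [hwv]
          · simp [hcon' w hw hwv]
        have := Finset.card_le_card hcsub
        have := hc.card_eq
        have := Finset.card_le_two (a := v) (b := (a : V))
        omega
      have h1 := hadj v hcon.1 w hw hwv.symm
      have h2 := hadj a hcon.2 w hw hwa.symm
      exact h1.2 (hYv a a.2 w h1.1 h2.1)
    have hgv' : v ∉ c ∨ g a ∉ c := by
      by_contra! hcon
      exact (hadj v hcon.1 _ hcon.2 (hgv a).ne).2 (hYv a a.2 _ (hgv a) (hga a))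
    have hga' : (a : V) ∉ c ∨ g a ∉ c := by
      by_contra! hcon
      exact (hadj a hcon.1 _ hcon.2 (hga a).ne).2 (hYg a)
    apply hns
    rintro x ⟨hx, hx'⟩ y ⟨hy, hy'⟩
    rw [Finset.mem_coe] at hx hy
    rcases (htri a x).1 hx' with rfl | rfl | rfl <;> rcases (htri a y).1 hy' with rfl | rfl | rfl <;>
      first | rfl | exact absurd hx (by tauto)

end SimpleGraph

/-! ### Certificates for the excluded configurations -/

namespace SimpleGraph

variable {V : Type*} {G : SimpleGraph V}

/-- In all the certificates, numerals index the vector of vertices that follows the pattern. A leaf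
lists the packed triangles and then the deleted edges. -/
lemma IsTuzaTight.false_of_degree_one (hG : G.IsTuzaTight) {v a : V}
    (nd : [v, a].Nodup)
    (hv : ∀ w, G.Adj v w ↔ w ∈ [a]) : False :=
  hG.false_of_refutedBy
    ⟨[(0, [1])], [], [], []⟩
    ![v, a]
    .absurd
    (by decide +kernel) (by simpa using nd) hv trivial trivial trivial

lemma IsTuzaTight.false_of_degree_two (hG : G.IsTuzaTight) {v a b : V}
    (nd : [v, a, b].Nodup)
    (hv : ∀ w, G.Adj v w ↔ w ∈ [a, b]) : False :=
  hG.false_of_refutedBy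
    ⟨[(0, [1, 2])], [], [], []⟩
    ![v, a, b]
    (.branch 1 2 (.leaf [(0, 1, 2)] [(1, 2)]) .absurd)
    (by decide +kernel) (by simpa using nd) hv trivial trivial trivial

lemma IsTuzaTight.false_of_degree_three (hG : G.IsTuzaTight) {v a b c : V}
    (nd : [v, a, b, c].Nodup)
    (hv : ∀ w, G.Adj v w ↔ w ∈ [a, b, c]) : False :=
  hG.false_of_refutedBy
    ⟨[(0, [1, 2, 3])], [], [], []⟩
    ![v, a, b, c]
    (.branch 1 2 (.leaf [(0, 1, 2)] [(0, 3), (1, 2)]) (.branch 1 3 (.leaf [(0, 1, 3)] [(1, 3), (2,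
      3)]) .absurd))
    (by decide +kernel) (by simpa using nd) hv trivial trivial trivial

lemma IsTuzaTight.false_of_degree_four (hG : G.IsTuzaTight) {v a b c d : V}
    (nd : [v, a, b, c, d].Nodup)
    (hv : ∀ w, G.Adj v w ↔ w ∈ [a, b, c, d]) : False :=
  hG.false_of_refutedBy
    ⟨[(0, [1, 2, 3, 4])], [], [], []⟩
    ![v, a, b, c, d]
    (.branch 1 2 (.branch 3 4 (.leaf [(0, 1, 2), (0, 3, 4)] [(0, 1), (0, 2), (1, 2), (3, 4)])
      (.branch 1 3 (.branch 1 4 (.branch 2 3 (.leaf [(0, 1, 4), (0, 2, 3)] [(0, 1), (0, 2), (1, 4),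
      (2, 3)]) (.leaf [(0, 1, 3)] [(0, 1), (1, 3)])) (.leaf [(0, 1, 3)] [(0, 2), (1, 3)])) (.branch 1
      4 (.leaf [(0, 1, 4)] [(0, 2), (1, 4)]) (.leaf [(0, 1, 2)] [(0, 2), (1, 2)])))) (.branch 1 3
      (.branch 1 4 (.branch 2 3 (.leaf [(0, 1, 4), (0, 2, 3)] [(0, 2), (0, 3), (1, 4), (2, 3)]) (.leaf
      [(0, 1, 3)] [(0, 4), (1, 3)])) (.leaf [(0, 1, 3)] [(0, 3), (1, 3)])) (.branch 1 4 (.leaf [(0, 1,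
      4)] [(0, 4), (1, 4)]) .absurd)))
    (by decide +kernel) (by simpa using nd) hv trivial trivial trivial

lemma IsTuzaTight.false_of_degree_five (hG : G.IsTuzaTight) {v a b c d e : V}
    (nd : [v, a, b, c, d, e].Nodup)
    (hv : ∀ w, G.Adj v w ↔ w ∈ [a, b, c, d, e])
    (nab : ¬ G.Adj a b) (nac : ¬ G.Adj a c) : False :=
  hG.false_of_refutedBy
    ⟨[(0, [1, 2, 3, 4, 5])], [], [], [(1, 2), (1, 3)]⟩
    ![v, a, b, c, d, e]
    (.branch 1 4 (.branch 1 5 (.branch 2 3 (.leaf [(0, 1, 4), (0, 2, 3)] [(0, 4), (0, 5), (1, 4),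
      (2, 3)]) (.branch 2 4 (.leaf [(0, 1, 5), (0, 2, 4)] [(0, 4), (0, 5), (1, 5), (2, 4)]) (.branch 2
      5 (.leaf [(0, 1, 4), (0, 2, 5)] [(0, 3), (0, 5), (1, 4), (2, 5)]) .absurd))) (.leaf [(0, 1, 4)]
      [(0, 4), (1, 4)])) (.branch 1 5 (.leaf [(0, 1, 5)] [(0, 5), (1, 5)]) .absurd))
    (by decide +kernel) (by simpa using nd) hv trivial trivial ⟨nab, nac⟩

/-- Only the case where `a` has two neighbours in `N(v)` is needed here; with at most one, `{a}` is
a crown. -/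
lemma IsTuzaTight.false_of_degree_six (hG : G.IsTuzaTight) {v a b c d e f : V}
    (nd : [v, a, b, c, d, e, f].Nodup)
    (hv : ∀ w, G.Adj v w ↔ w ∈ [a, b, c, d, e, f])
    (had : G.Adj a d) (hae : G.Adj a e) (nab : ¬ G.Adj a b) (nac : ¬ G.Adj a c) : False :=
  hG.false_of_refutedBy
    ⟨[(0, [1, 2, 3, 4, 5, 6])], [], [(1, 4), (1, 5)], [(1, 2), (1, 3)]⟩
    ![v, a, b, c, d, e, f]
    (.branch 2 3 (.branch 4 6 (.leaf [(0, 1, 5), (0, 2, 3), (0, 4, 6)] [(0, 4), (0, 5), (0, 6), (1,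
      5), (2, 3), (4, 6)]) (.branch 5 6 (.leaf [(0, 1, 4), (0, 2, 3), (0, 5, 6)] [(0, 4), (0, 5), (0,
      6), (1, 4), (2, 3), (5, 6)]) (.branch 1 6 (.branch 4 5 (.leaf [(0, 1, 6), (0, 2, 3), (0, 4, 5)]
      [(0, 1), (0, 2), (0, 3), (1, 6), (2, 3), (4, 5)]) (.branch 2 4 (.branch 3 5 (.leaf [(0, 1, 6),
      (0, 2, 4), (0, 3, 5)] [(0, 1), (0, 2), (0, 3), (1, 6), (2, 4), (3, 5)]) (.branch 2 5 (.branch 3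
      4 (.leaf [(0, 1, 6), (0, 2, 5), (0, 3, 4)] [(0, 1), (0, 2), (0, 3), (1, 6), (2, 5), (3, 4)])
      (.leaf [(0, 1, 4), (0, 2, 5)] [(0, 1), (0, 2), (1, 4), (2, 5)])) (.leaf [(0, 1, 5), (0, 2, 3)]
      [(0, 4), (0, 6), (1, 5), (2, 3)]))) (.branch 3 4 (.branch 2 5 (.leaf [(0, 1, 6), (0, 2, 5), (0,
      3, 4)] [(0, 1), (0, 2), (0, 3), (1, 6), (2, 5), (3, 4)]) (.leaf [(0, 1, 5), (0, 3, 4)] [(0, 1),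
      (0, 3), (1, 5), (3, 4)])) (.leaf [(0, 1, 4), (0, 2, 3)] [(0, 5), (0, 6), (1, 4), (2, 3)]))))
      (.branch 2 4 (.branch 3 5 (.branch 2 6 (.leaf [(0, 1, 4), (0, 2, 6), (0, 3, 5)] [(0, 2), (0, 3),
      (0, 5), (1, 4), (2, 6), (3, 5)]) (.branch 2 5 (.leaf [(0, 1, 5), (0, 2, 4), (2, 3, 5)] [(0, 4),
      (1, 5), (2, 3), (2, 4), (2, 5), (3, 5)]) (.leaf [(0, 1, 5), (0, 2, 4)] [(0, 3), (0, 4), (1, 5),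
      (2, 4)]))) (.leaf [(0, 1, 5), (0, 2, 4)] [(0, 2), (0, 4), (1, 5), (2, 4)])) (.branch 2 6 (.leaf
      [(0, 1, 4), (0, 2, 6)] [(0, 3), (0, 5), (1, 4), (2, 6)]) (.leaf [(0, 1, 4), (0, 2, 3)] [(0, 3),
      (0, 5), (1, 4), (2, 3)])))))) (.branch 2 4 (.branch 3 6 (.leaf [(0, 1, 5), (0, 2, 4), (0, 3, 6)]
      [(0, 4), (0, 5), (0, 6), (1, 5), (2, 4), (3, 6)]) (.branch 3 5 (.branch 1 6 (.leaf [(0, 1, 6),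
      (0, 2, 4), (0, 3, 5)] [(0, 2), (0, 4), (0, 5), (1, 6), (2, 4), (3, 5)]) (.leaf [(0, 1, 4), (0,
      3, 5)] [(0, 4), (0, 5), (1, 4), (3, 5)])) (.branch 3 4 (.leaf [(0, 3, 4)] [(0, 4), (3, 4)])
      .absurd))) (.branch 2 6 (.branch 3 4 (.leaf [(0, 1, 5), (0, 2, 6), (0, 3, 4)] [(0, 1), (0, 5),
      (0, 6), (1, 5), (2, 6), (3, 4)]) (.leaf [(0, 1, 4), (0, 2, 6)] [(0, 5), (0, 6), (1, 4), (2,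
      6)])) (.branch 2 5 (.leaf [(0, 2, 5)] [(0, 5), (2, 5)]) .absurd))))
    (by decide +kernel) (by simpa using nd) hv trivial ⟨had, hae⟩ ⟨nab, nac⟩

/-- In this family `x, y, z` (and `t`, `s`) are common neighbours of the edge `uv`, the remaining
letters private ones. The assumed edges, a path on three or a 4-cycle on four common neighbours, are
those guaranteed by a near-clique. Without private neighbours on either side `u` and `v` are twins;
with none at `u` alone, `u` is dominated. -/
lemma IsTuzaTight.false_of_adj_five_five (hG : G.IsTuzaTight) {u v x y z b c : V}
    (nd : [u, v, x, y, z, b, c].Nodup)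
    (hu : ∀ w, G.Adj u w ↔ w ∈ [v, x, y, z, b])
    (hv : ∀ w, G.Adj v w ↔ w ∈ [u, x, y, z, c])
    (hxz : G.Adj x z) (hyz : G.Adj y z) (hbx : G.Adj b x) (hby : G.Adj b y) (hbz : G.Adj b z)
    (hcx : G.Adj c x) (hcy : G.Adj c y) (hcz : G.Adj c z) : False :=
  hG.false_of_refutedBy
    ⟨[(0, [1, 2, 3, 4, 5]), (1, [0, 2, 3, 4, 6])], [], [(2, 4), (3, 4), (5, 2), (5, 3), (5, 4), (6, 2), (6, 3), (6, 4)], []⟩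
    ![u, v, x, y, z, b, c]
    (.leaf [(0, 1, 4), (0, 2, 5), (1, 3, 6), (2, 4, 6), (3, 4, 5)] [(0, 1), (2, 3), (2, 4), (2, 5),
      (2, 6), (3, 4), (3, 5), (3, 6), (4, 5), (4, 6)])
    (by decide +kernel) (by simpa using nd) ⟨hu, hv⟩ trivial
    ⟨hxz, hyz, hbx, hby, hbz, hcx, hcy, hcz⟩ trivial

lemma IsTuzaTight.false_of_adj_five_five_twins (hG : G.IsTuzaTight) {u v x y z t : V}
    (nd : [u, v, x, y, z, t].Nodup)
    (hu : ∀ w, G.Adj u w ↔ w ∈ [v, x, y, z, t])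
    (hv : ∀ w, G.Adj v w ↔ w ∈ [u, x, y, z, t])
    (hxy : G.Adj x y) (hxz : G.Adj x z) (hyt : G.Adj y t) (hzt : G.Adj z t) : False :=
  hG.false_of_refutedBy
    ⟨[(0, [1, 2, 3, 4, 5]), (1, [0, 2, 3, 4, 5])], [], [(2, 3), (2, 4), (3, 5), (4, 5)], []⟩
    ![u, v, x, y, z, t]
    (.leaf [(0, 2, 4), (0, 3, 5), (1, 2, 3), (1, 4, 5)] [(0, 1), (2, 3), (2, 4), (2, 5), (3, 4), (3,
      5), (4, 5)])
    (by decide +kernel) (by simpa using nd) ⟨hu, hv⟩ trivial ⟨hxy, hxz, hyt, hzt⟩ trivial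

lemma IsTuzaTight.false_of_adj_five_six (hG : G.IsTuzaTight) {u v x y z t c : V}
    (nd : [u, v, x, y, z, t, c].Nodup)
    (hu : ∀ w, G.Adj u w ↔ w ∈ [v, x, y, z, t])
    (hv : ∀ w, G.Adj v w ↔ w ∈ [u, x, y, z, t, c])
    (hxy : G.Adj x y) (hxz : G.Adj x z) (hyt : G.Adj y t) (hzt : G.Adj z t) : False :=
  hG.false_of_refutedBy
    ⟨[(0, [1, 2, 3, 4, 5]), (1, [0, 2, 3, 4, 5, 6])], [], [(2, 3), (2, 4), (3, 5), (4, 5)], []⟩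
    ![u, v, x, y, z, t, c]
    (.leaf [(0, 2, 4), (0, 3, 5), (1, 2, 3), (1, 4, 5)] [(0, 1), (1, 6), (2, 3), (2, 4), (2, 5), (3,
      4), (3, 5), (4, 5)])
    (by decide +kernel) (by simpa using nd) ⟨hu, hv⟩ trivial ⟨hxy, hxz, hyt, hzt⟩ trivial

lemma IsTuzaTight.false_of_adj_six_six (hG : G.IsTuzaTight) {u v x y z t b c : V}
    (nd : [u, v, x, y, z, t, b, c].Nodup)
    (hu : ∀ w, G.Adj u w ↔ w ∈ [v, x, y, z, t, b])
    (hv : ∀ w, G.Adj v w ↔ w ∈ [u, x, y, z, t, c])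
    (hxy : G.Adj x y) (hxz : G.Adj x z) (hyt : G.Adj y t) (hzt : G.Adj z t) (hbx : G.Adj b x)
    (hby : G.Adj b y) (hbz : G.Adj b z) (hbt : G.Adj b t) (hcx : G.Adj c x) (hcy : G.Adj c y)
    (hcz : G.Adj c z) (hct : G.Adj c t) : False :=
  hG.false_of_refutedBy
    ⟨[(0, [1, 2, 3, 4, 5, 6]), (1, [0, 2, 3, 4, 5, 7])], [], [(2, 3), (2, 4), (3, 5), (4, 5), (6, 2), (6, 3), (6, 4), (6, 5), (7, 2), (7, 3), (7, 4), (7, 5)], []⟩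
    ![u, v, x, y, z, t, b, c]
    (.leaf [(0, 1, 5), (0, 2, 4), (0, 3, 6), (1, 2, 3), (1, 4, 7), (3, 5, 7), (4, 5, 6)] [(0, 1),
      (0, 2), (1, 2), (2, 3), (2, 4), (3, 4), (3, 5), (3, 6), (3, 7), (4, 5), (4, 6), (4, 7), (5, 6),
      (5, 7)])
    (by decide +kernel) (by simpa using nd) ⟨hu, hv⟩ trivial
    ⟨hxy, hxz, hyt, hzt, hbx, hby, hbz, hbt, hcx, hcy, hcz, hct⟩ trivial

lemma IsTuzaTight.false_of_adj_six_six_twins (hG : G.IsTuzaTight) {u v x y z t s : V}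
    (nd : [u, v, x, y, z, t, s].Nodup)
    (hu : ∀ w, G.Adj u w ↔ w ∈ [v, x, y, z, t, s])
    (hv : ∀ w, G.Adj v w ↔ w ∈ [u, x, y, z, t, s])
    (hxy : G.Adj x y) (hxz : G.Adj x z) (hyt : G.Adj y t) (hzt : G.Adj z t) : False :=
  hG.false_of_refutedBy
    ⟨[(0, [1, 2, 3, 4, 5, 6]), (1, [0, 2, 3, 4, 5, 6])], [], [(2, 3), (2, 4), (3, 5), (4, 5)], []⟩
    ![u, v, x, y, z, t, s]
    (.leaf [(0, 1, 6), (0, 2, 4), (0, 3, 5), (1, 2, 3), (1, 4, 5)] [(0, 4), (0, 5), (0, 6), (1, 2),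
      (1, 3), (1, 6), (2, 3), (2, 4), (3, 5), (4, 5)])
    (by decide +kernel) (by simpa using nd) ⟨hu, hv⟩ trivial ⟨hxy, hxz, hyt, hzt⟩ trivial

lemma IsTuzaTight.false_of_adj_six_seven_dominated (hG : G.IsTuzaTight) {u v x y z t s c : V}
    (nd : [u, v, x, y, z, t, s, c].Nodup)
    (hu : ∀ w, G.Adj u w ↔ w ∈ [v, x, y, z, t, s])
    (hv : ∀ w, G.Adj v w ↔ w ∈ [u, x, y, z, t, s, c])
    (hxy : G.Adj x y) (hxz : G.Adj x z) (hyt : G.Adj y t) (hzt : G.Adj z t) : False :=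
  hG.false_of_refutedBy
    ⟨[(0, [1, 2, 3, 4, 5, 6]), (1, [0, 2, 3, 4, 5, 6, 7])], [], [(2, 3), (2, 4), (3, 5), (4, 5)], []⟩
    ![u, v, x, y, z, t, s, c]
    (.leaf [(0, 1, 6), (0, 2, 4), (0, 3, 5), (1, 2, 3), (1, 4, 5)] [(0, 1), (0, 6), (1, 6), (1, 7),
      (2, 3), (2, 4), (2, 5), (3, 4), (3, 5), (4, 5)])
    (by decide +kernel) (by simpa using nd) ⟨hu, hv⟩ trivial ⟨hxy, hxz, hyt, hzt⟩ trivial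

lemma IsTuzaTight.false_of_adj_six_seven (hG : G.IsTuzaTight) {u v x y z t b c d : V}
    (nd : [u, v, x, y, z, t, b, c, d].Nodup)
    (hu : ∀ w, G.Adj u w ↔ w ∈ [v, x, y, z, t, b])
    (hv : ∀ w, G.Adj v w ↔ w ∈ [u, x, y, z, t, c, d])
    (hxy : G.Adj x y) (hxz : G.Adj x z) (hyt : G.Adj y t) (hzt : G.Adj z t) (hbx : G.Adj b x)
    (hby : G.Adj b y) (hbz : G.Adj b z) (hbt : G.Adj b t) : False :=
  hG.false_of_refutedBy
    ⟨[(0, [1, 2, 3, 4, 5, 6]), (1, [0, 2, 3, 4, 5, 7, 8])], [], [(2, 3), (2, 4), (3, 5), (4, 5), (6, 2), (6, 3), (6, 4), (6, 5)], []⟩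
    ![u, v, x, y, z, t, b, c, d]
    (.branch 2 5 (.branch 2 7 (.leaf [(0, 1, 3), (0, 2, 4), (0, 5, 6), (1, 2, 7), (1, 4, 5), (2, 3,
      5)] [(0, 1), (0, 6), (1, 7), (1, 8), (2, 3), (2, 4), (2, 5), (2, 7), (3, 4), (3, 5), (4, 5), (5,
      6)]) (.branch 2 8 (.leaf [(0, 1, 4), (0, 2, 3), (0, 5, 6), (1, 2, 8), (1, 3, 5), (2, 4, 5)] [(0,
      1), (0, 6), (1, 7), (1, 8), (2, 3), (2, 4), (2, 5), (2, 8), (3, 4), (3, 5), (4, 5), (5, 6)])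
      (.leaf [(0, 1, 3), (0, 2, 4), (0, 5, 6), (1, 2, 5)] [(0, 2), (0, 3), (0, 4), (1, 3), (1, 5), (2,
      4), (2, 5), (5, 6)]))) (.branch 3 4 (.leaf [(0, 1, 2), (0, 3, 5), (0, 4, 6), (1, 4, 5), (2, 3,
      4)] [(0, 1), (0, 6), (1, 7), (1, 8), (2, 3), (2, 4), (3, 4), (3, 5), (4, 5), (4, 6)]) (.leaf
      [(0, 2, 4), (0, 3, 5), (1, 2, 3), (1, 4, 5)] [(0, 1), (0, 6), (1, 7), (1, 8), (2, 3), (2, 4),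
      (3, 5), (4, 5)])))
    (by decide +kernel) (by simpa using nd) ⟨hu, hv⟩ trivial
    ⟨hxy, hxz, hyt, hzt, hbx, hby, hbz, hbt⟩ trivial

lemma IsTuzaTight.false_of_adj_five_seven_dominated (hG : G.IsTuzaTight) {u v x y z t c d : V}
    (nd : [u, v, x, y, z, t, c, d].Nodup)
    (hu : ∀ w, G.Adj u w ↔ w ∈ [v, x, y, z, t])
    (hv : ∀ w, G.Adj v w ↔ w ∈ [u, x, y, z, t, c, d])
    (hxy : G.Adj x y) (hxz : G.Adj x z) (hyt : G.Adj y t) (hzt : G.Adj z t) : False :=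
  hG.false_of_refutedBy
    ⟨[(0, [1, 2, 3, 4, 5]), (1, [0, 2, 3, 4, 5, 6, 7])], [], [(2, 3), (2, 4), (3, 5), (4, 5)], []⟩
    ![u, v, x, y, z, t, c, d]
    (.branch 2 5 (.branch 2 6 (.leaf [(0, 1, 4), (0, 2, 3), (1, 2, 6), (1, 3, 5), (2, 4, 5)] [(0,
      1), (1, 6), (1, 7), (2, 3), (2, 4), (2, 5), (2, 6), (3, 4), (3, 5), (4, 5)]) (.branch 2 7 (.leaf
      [(0, 1, 3), (0, 2, 4), (1, 2, 7), (1, 4, 5), (2, 3, 5)] [(0, 1), (1, 6), (1, 7), (2, 3), (2, 4),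
      (2, 5), (2, 7), (3, 4), (3, 5), (4, 5)]) (.branch 3 4 (.branch 3 6 (.leaf [(0, 1, 2), (0, 3, 5),
      (1, 3, 6), (1, 4, 5), (2, 3, 4)] [(0, 1), (1, 6), (1, 7), (2, 3), (2, 4), (2, 5), (3, 4), (3,
      5), (3, 6), (4, 5)]) (.branch 3 7 (.leaf [(0, 1, 4), (0, 2, 3), (1, 2, 5), (1, 3, 7), (3, 4, 5)]
      [(0, 1), (1, 6), (1, 7), (2, 3), (2, 4), (2, 5), (3, 4), (3, 5), (3, 7), (4, 5)]) (.leaf [(0, 1,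
      4), (0, 2, 5), (1, 2, 3), (3, 4, 5)] [(0, 1), (1, 4), (2, 3), (2, 4), (2, 5), (3, 4), (3, 5),
      (4, 5)]))) (.leaf [(0, 1, 5), (0, 2, 4), (1, 2, 3)] [(0, 1), (0, 5), (1, 3), (1, 5), (2, 3), (2,
      4)])))) (.leaf [(0, 2, 3), (0, 4, 5), (1, 2, 4), (1, 3, 5)] [(0, 1), (1, 6), (1, 7), (2, 3), (2,
      4), (3, 4), (3, 5), (4, 5)]))
    (by decide +kernel) (by simpa using nd) ⟨hu, hv⟩ trivial ⟨hxy, hxz, hyt, hzt⟩ trivial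

/-- Each of this and the next two lemmas refutes one missing edge. Together they make `x, y, z, c,
d, e`, the neighbours of the degree-seven vertex `v` other than `u`, a clique. -/
lemma IsTuzaTight.adj_of_adj_five_seven (hG : G.IsTuzaTight) {u v x y z b c d e : V}
    (nd : [u, v, x, y, z, b, c, d, e].Nodup)
    (hu : ∀ w, G.Adj u w ↔ w ∈ [v, x, y, z, b])
    (hv : ∀ w, G.Adj v w ↔ w ∈ [u, x, y, z, c, d, e])
    (hxz : G.Adj x z) (hyz : G.Adj y z) (hbx : G.Adj b x) (hby : G.Adj b y) (hbz : G.Adj b z)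
    (nxy : ¬ G.Adj x y) : False :=
  hG.false_of_refutedBy
    ⟨[(0, [1, 2, 3, 4, 5]), (1, [0, 2, 3, 4, 6, 7, 8])], [], [(2, 4), (3, 4), (5, 2), (5, 3), (5, 4)], [(2, 3)]⟩
    ![u, v, x, y, z, b, c, d, e]
    (.leaf [(0, 1, 3), (0, 2, 5), (1, 2, 4), (3, 4, 5)] [(1, 2), (1, 3), (1, 4), (2, 4), (2, 5), (3,
      4), (3, 5), (4, 5)])
    (by decide +kernel) (by simpa using nd) ⟨hu, hv⟩ trivial ⟨hxz, hyz, hbx, hby, hbz⟩ nxy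

lemma IsTuzaTight.adj_outer_of_adj_five_seven (hG : G.IsTuzaTight) {u v x y z b c d e : V}
    (nd : [u, v, x, y, z, b, c, d, e].Nodup)
    (hu : ∀ w, G.Adj u w ↔ w ∈ [v, x, y, z, b])
    (hv : ∀ w, G.Adj v w ↔ w ∈ [u, x, y, z, c, d, e])
    (hxy : G.Adj x y) (hxz : G.Adj x z) (hyz : G.Adj y z) (hbx : G.Adj b x) (hby : G.Adj b y)
    (hbz : G.Adj b z) (nxc : ¬ G.Adj x c) : False :=
  hG.false_of_refutedBy
    ⟨[(0, [1, 2, 3, 4, 5]), (1, [0, 2, 3, 4, 6, 7, 8])], [], [(2, 3), (2, 4), (3, 4), (5, 2), (5, 3), (5, 4)], [(2, 6)]⟩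
    ![u, v, x, y, z, b, c, d, e]
    (.branch 2 7 (.branch 3 6 (.branch 4 6 (.branch 6 7 (.leaf [(0, 1, 3), (0, 4, 5), (1, 2, 4), (1,
      6, 7), (2, 3, 5), (3, 4, 6)] [(0, 1), (1, 7), (1, 8), (2, 3), (2, 4), (2, 5), (3, 4), (3, 5),
      (3, 6), (4, 5), (4, 6), (6, 7)]) (.leaf [(0, 1, 4), (0, 2, 3), (1, 2, 7), (1, 3, 6), (3, 4, 5)]
      [(0, 2), (1, 3), (1, 4), (1, 8), (2, 3), (2, 7), (3, 4), (3, 5), (3, 6), (4, 5)])) (.leaf [(0,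
      1, 4), (0, 2, 5), (1, 2, 7), (1, 3, 6), (2, 3, 4)] [(0, 1), (0, 5), (1, 7), (1, 8), (2, 3), (2,
      4), (2, 5), (2, 7), (3, 4), (3, 6)])) (.branch 4 6 (.leaf [(0, 1, 3), (0, 4, 5), (1, 2, 7), (1,
      4, 6), (2, 3, 4)] [(0, 1), (0, 5), (1, 7), (1, 8), (2, 3), (2, 4), (2, 7), (3, 4), (4, 5), (4,
      6)]) (.branch 3 8 (.leaf [(0, 1, 4), (0, 3, 5), (1, 2, 7), (1, 3, 8), (2, 3, 4)] [(0, 1), (0,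
      5), (1, 7), (1, 8), (2, 3), (2, 4), (2, 7), (3, 4), (3, 5), (3, 8)]) (.branch 2 8 (.branch 3 7
      (.leaf [(0, 1, 4), (0, 2, 5), (1, 2, 8), (1, 3, 7), (2, 3, 4)] [(0, 1), (0, 5), (1, 7), (1, 8),
      (2, 3), (2, 4), (2, 5), (2, 8), (3, 4), (3, 7)]) (.leaf [(0, 1, 2), (0, 3, 5), (1, 3, 4), (2, 4,
      5)] [(0, 3), (1, 2), (1, 4), (2, 4), (2, 5), (3, 4), (3, 5), (4, 5)])) (.leaf [(0, 1, 3), (0, 2,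
      5), (1, 2, 7), (2, 3, 4)] [(0, 1), (0, 5), (1, 7), (2, 3), (2, 4), (2, 5), (2, 7), (3, 4)])))))
      (.branch 2 8 (.branch 6 7 (.leaf [(0, 1, 3), (0, 2, 5), (1, 2, 4), (1, 6, 7), (3, 4, 5)] [(0,
      2), (1, 3), (1, 4), (1, 8), (2, 4), (2, 5), (3, 4), (3, 5), (4, 5), (6, 7)]) (.branch 3 6 (.leaf
      [(0, 1, 4), (0, 3, 5), (1, 2, 8), (1, 3, 6)] [(0, 2), (0, 4), (1, 3), (1, 4), (1, 8), (2, 8),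
      (3, 5), (3, 6)]) (.branch 3 7 (.leaf [(0, 1, 4), (0, 2, 5), (1, 2, 8), (1, 3, 7)] [(0, 3), (0,
      4), (1, 2), (1, 4), (1, 8), (2, 5), (2, 8), (3, 7)]) (.leaf [(0, 1, 3), (0, 2, 5), (1, 2, 8),
      (2, 3, 4)] [(0, 1), (0, 5), (1, 8), (2, 3), (2, 4), (2, 5), (2, 8), (3, 4)])))) (.leaf [(0, 1,
      4), (0, 3, 5), (1, 2, 3)] [(0, 2), (0, 4), (1, 3), (1, 4), (2, 3), (3, 5)])))
    (by decide +kernel) (by simpa using nd) ⟨hu, hv⟩ trivial ⟨hxy, hxz, hyz, hbx, hby, hbz⟩ nxc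

lemma IsTuzaTight.outer_adj_of_adj_five_seven (hG : G.IsTuzaTight) {u v x y z b c d e : V}
    (nd : [u, v, x, y, z, b, c, d, e].Nodup)
    (hu : ∀ w, G.Adj u w ↔ w ∈ [v, x, y, z, b])
    (hv : ∀ w, G.Adj v w ↔ w ∈ [u, x, y, z, c, d, e])
    (hxy : G.Adj x y) (hxz : G.Adj x z) (hyz : G.Adj y z) (hbx : G.Adj b x) (hby : G.Adj b y)
    (hbz : G.Adj b z) (hcx : G.Adj c x) (hcy : G.Adj c y) (hcz : G.Adj c z) (hdx : G.Adj d x)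
    (hdy : G.Adj d y) (hdz : G.Adj d z) (hex : G.Adj e x) (hey : G.Adj e y) (hez : G.Adj e z)
    (ncd : ¬ G.Adj c d) : False :=
  hG.false_of_refutedBy
    ⟨[(0, [1, 2, 3, 4, 5]), (1, [0, 2, 3, 4, 6, 7, 8])], [], [(2, 3), (2, 4), (3, 4), (5, 2), (5, 3), (5, 4), (6, 2), (6, 3), (6, 4), (7, 2), (7, 3), (7, 4), (8, 2), (8, 3), (8, 4)], [(6, 7)]⟩
    ![u, v, x, y, z, b, c, d, e]
    (.leaf [(0, 2, 5), (0, 3, 4), (1, 2, 8), (1, 3, 7), (1, 4, 6), (2, 3, 6), (2, 4, 7)] [(0, 1),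
      (0, 5), (1, 8), (2, 3), (2, 4), (2, 5), (2, 6), (2, 7), (2, 8), (3, 4), (3, 6), (3, 7), (4, 6),
      (4, 7)])
    (by decide +kernel) (by simpa using nd) ⟨hu, hv⟩ trivial
    ⟨hxy, hxz, hyz, hbx, hby, hbz, hcx, hcy, hcz, hdx, hdy, hdz, hex, hey, hez⟩ ncd

/-- A perfect matching of `N(v)` gives four triangles at `v`. Delete the matching and the spokes to
`y, z, s, t`: the remaining spokes end in `p, q, r, x`, whose only edge `px` is deleted. -/
lemma IsTuzaTight.false_of_degree_eight_of_matching (hG : G.IsTuzaTight) {v p q r x y z s t : V}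
    (nd : [v, p, q, r, x, y, z, s, t].Nodup)
    (hv : ∀ w, G.Adj v w ↔ w ∈ [p, q, r, x, y, z, s, t])
    (hpx : G.Adj p x) (hqy : G.Adj q y) (hrz : G.Adj r z) (hst : G.Adj s t) (npq : ¬ G.Adj p q)
    (npr : ¬ G.Adj p r) (nqr : ¬ G.Adj q r) (nxq : ¬ G.Adj x q) (nxr : ¬ G.Adj x r) : False :=
  hG.false_of_refutedBy
    ⟨[(0, [1, 2, 3, 4, 5, 6, 7, 8])], [], [(1, 4), (2, 5), (3, 6), (7, 8)], [(1, 2), (1, 3), (2, 3), (4, 2), (4, 3)]⟩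
    ![v, p, q, r, x, y, z, s, t]
    (.leaf [(0, 1, 4), (0, 2, 5), (0, 3, 6), (0, 7, 8)] [(0, 5), (0, 6), (0, 7), (0, 8), (1, 4), (2,
      5), (3, 6), (7, 8)])
    (by decide +kernel) (by simpa using nd) hv trivial ⟨hpx, hqy, hrz, hst⟩
    ⟨npq, npr, nqr, nxq, nxr⟩

/-- Here and below `p, q, r` miss `a, b, c` respectively. The suffix counts how many of them miss a
second vertex among `d, e`, and so have a neighbour `m` or `n` outside `N(v) ∪ {v}`. -/
lemma IsTuzaTight.false_of_degree_eight_of_misses (hG : G.IsTuzaTight) {v p q r a b c d e : V}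
    (nd : [v, p, q, r, a, b, c, d, e].Nodup)
    (hv : ∀ w, G.Adj v w ↔ w ∈ [p, q, r, a, b, c, d, e])
    (hp : ∀ w, G.Adj p w ↔ w ∈ [v, b, c, d, e])
    (hq : ∀ w, G.Adj q w ↔ w ∈ [v, a, c, d, e])
    (hr : ∀ w, G.Adj r w ↔ w ∈ [v, a, b, d, e])
    (np : G.IsNearClique p) (nq : G.IsNearClique q) (nr : G.IsNearClique r) : False :=
  hG.false_of_refutedBy
    ⟨[(0, [1, 2, 3, 4, 5, 6, 7, 8]), (1, [0, 5, 6, 7, 8]), (2, [0, 4, 6, 7, 8]), (3, [0, 4, 5, 7, 8])], [1, 2, 3], [], []⟩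
    ![v, p, q, r, a, b, c, d, e]
    (.branch 4 5 (.branch 7 8 (.leaf [(0, 1, 6), (0, 2, 4), (0, 3, 8), (1, 7, 8), (3, 4, 5)] [(0,
      6), (0, 7), (0, 8), (1, 5), (1, 6), (2, 4), (3, 4), (3, 5), (4, 5), (7, 8)]) (.leaf [(0, 1, 5),
      (0, 2, 4), (0, 3, 8), (3, 4, 5)] [(0, 6), (0, 7), (0, 8), (1, 5), (2, 4), (3, 4), (3, 5), (4,
      5)])) (.branch 4 7 (.branch 4 8 (.leaf [(0, 1, 6), (0, 2, 8), (0, 3, 5), (0, 4, 7), (3, 4, 8)]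
      [(0, 4), (0, 5), (0, 7), (0, 8), (1, 6), (2, 6), (3, 5), (4, 7), (4, 8), (7, 8)]) .absurd)
      .absurd))
    (by decide +kernel) (by simpa using nd) ⟨hv, hp, hq, hr⟩ ⟨np, nq, nr⟩ trivial trivial

lemma IsTuzaTight.false_of_degree_eight_of_misses_one (hG : G.IsTuzaTight) {v p q r a b c d e m : V}
    (nd : [v, p, q, r, a, b, c, d, e, m].Nodup)
    (hv : ∀ w, G.Adj v w ↔ w ∈ [p, q, r, a, b, c, d, e])
    (hp : ∀ w, G.Adj p w ↔ w ∈ [v, b, c, e, m])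
    (hq : ∀ w, G.Adj q w ↔ w ∈ [v, a, c, d, e])
    (hr : ∀ w, G.Adj r w ↔ w ∈ [v, a, b, d, e])
    (np : G.IsNearClique p) (nq : G.IsNearClique q) (nr : G.IsNearClique r) : False :=
  hG.false_of_refutedBy
    ⟨[(0, [1, 2, 3, 4, 5, 6, 7, 8]), (1, [0, 5, 6, 8, 9]), (2, [0, 4, 6, 7, 8]), (3, [0, 4, 5, 7, 8])], [1, 2, 3], [], []⟩
    ![v, p, q, r, a, b, c, d, e, m]
    (.branch 5 9 (.branch 4 5 (.leaf [(0, 1, 8), (0, 2, 6), (0, 3, 7), (0, 4, 5), (1, 5, 9)] [(0,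
      4), (0, 5), (0, 7), (0, 8), (1, 6), (1, 8), (2, 6), (3, 7), (4, 5), (5, 9)]) (.branch 4 7 (.leaf
      [(0, 1, 8), (0, 2, 6), (0, 3, 5), (0, 4, 7), (1, 5, 9)] [(0, 4), (0, 5), (0, 7), (0, 8), (1, 6),
      (1, 8), (2, 6), (3, 5), (4, 7), (5, 9)]) .absurd)) .absurd)
    (by decide +kernel) (by simpa using nd) ⟨hv, hp, hq, hr⟩ ⟨np, nq, nr⟩ trivial trivial

lemma IsTuzaTight.false_of_degree_eight_of_misses_two (hG : G.IsTuzaTight) {v p q r a b c d e m n : V}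
    (nd : [v, p, q, r, a, b, c, d, e, m, n].Nodup)
    (hv : ∀ w, G.Adj v w ↔ w ∈ [p, q, r, a, b, c, d, e])
    (hp : ∀ w, G.Adj p w ↔ w ∈ [v, b, c, e, m])
    (hq : ∀ w, G.Adj q w ↔ w ∈ [v, a, c, d, n])
    (hr : ∀ w, G.Adj r w ↔ w ∈ [v, a, b, d, e])
    (np : G.IsNearClique p) (nq : G.IsNearClique q) (nr : G.IsNearClique r) : False :=
  hG.false_of_refutedBy
    ⟨[(0, [1, 2, 3, 4, 5, 6, 7, 8]), (1, [0, 5, 6, 8, 9]), (2, [0, 4, 6, 7, 10]), (3, [0, 4, 5, 7, 8])], [1, 2, 3], [], []⟩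
    ![v, p, q, r, a, b, c, d, e, m, n]
    (.branch 4 10 (.branch 4 5 (.leaf [(0, 1, 8), (0, 2, 6), (0, 3, 7), (0, 4, 5), (2, 4, 10)] [(0,
      4), (0, 5), (0, 6), (0, 8), (1, 8), (2, 6), (2, 7), (3, 7), (4, 5), (4, 10)]) (.branch 4 8
      (.leaf [(0, 1, 6), (0, 2, 7), (0, 3, 5), (0, 4, 8), (2, 4, 10)] [(0, 4), (0, 5), (0, 7), (0, 8),
      (1, 6), (2, 6), (2, 7), (3, 5), (4, 8), (4, 10)]) .absurd)) .absurd)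
    (by decide +kernel) (by simpa using nd) ⟨hv, hp, hq, hr⟩ ⟨np, nq, nr⟩ trivial trivial

lemma IsTuzaTight.false_of_degree_eight_of_misses_two_of_eq (hG : G.IsTuzaTight) {v p q r a b c d e m : V}
    (nd : [v, p, q, r, a, b, c, d, e, m].Nodup)
    (hv : ∀ w, G.Adj v w ↔ w ∈ [p, q, r, a, b, c, d, e])
    (hp : ∀ w, G.Adj p w ↔ w ∈ [v, b, c, e, m])
    (hq : ∀ w, G.Adj q w ↔ w ∈ [v, a, c, d, m])
    (hr : ∀ w, G.Adj r w ↔ w ∈ [v, a, b, d, e])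
    (np : G.IsNearClique p) (nq : G.IsNearClique q) (nr : G.IsNearClique r) : False :=
  hG.false_of_refutedBy
    ⟨[(0, [1, 2, 3, 4, 5, 6, 7, 8]), (1, [0, 5, 6, 8, 9]), (2, [0, 4, 6, 7, 9]), (3, [0, 4, 5, 7, 8])], [1, 2, 3], [], []⟩
    ![v, p, q, r, a, b, c, d, e, m]
    (.branch 4 9 (.branch 6 9 (.leaf [(0, 1, 5), (0, 2, 6), (1, 6, 9), (2, 4, 9)] [(0, 5), (0, 6),
      (1, 5), (1, 8), (2, 4), (2, 7), (4, 9), (6, 9)]) .absurd) .absurd)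
    (by decide +kernel) (by simpa using nd) ⟨hv, hp, hq, hr⟩ ⟨np, nq, nr⟩ trivial trivial

end SimpleGraph

/-! ### Neighbourhood lists, minimum degree and near-cliques -/

namespace SimpleGraph

variable {V : Type*} {G : SimpleGraph V}

/-- Inside `N(u)` the vertex `v` already uses up the one non-neighbour allowed to `b`. -/
lemma IsNearClique.adj_of_common {u v b x : V} (hu : G.IsNearClique u) (huv : G.Adj u v)
    (hub : G.Adj u b) (hvb : ¬ G.Adj v b) (hne : b ≠ v) (hx : G.Adj u x ∧ G.Adj v x) :
    G.Adj b x :=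
  (hu b v x hub huv hx.1 hne (by rintro rfl; exact hvb hx.2) hx.2.ne).resolve_left
    fun h => hvb h.symm

variable [Fintype V] [DecidableEq V] [DecidableRel G.Adj]

/-- A list of distinct neighbours of `v` extends to a list of all neighbours. -/
lemma exists_neighbor_list_append (v : V) (k : List V) (hk : k.Nodup)
    (hkv : ∀ w ∈ k, G.Adj v w) :
    ∃ l : List V, (v :: (k ++ l)).Nodup ∧ k.length + l.length = G.degree v ∧
      ∀ w, G.Adj v w ↔ w ∈ k ++ l := by
  refine ⟨(G.neighborFinset v \ k.toFinset).toList, ?_, ?_, ?_⟩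
  · rw [List.nodup_cons, List.nodup_append']
    refine ⟨?_, hk, Finset.nodup_toList _, ?_⟩
    · intro h
      rcases List.mem_append.1 h with h | h
      · exact (hkv v h).ne rfl
      · simp at h
    · intro w hw hw'
      simp only [Finset.mem_toList, Finset.mem_sdiff, List.mem_toFinset] at hw'
      exact hw'.2 hw
  · have h1 : k.toFinset ⊆ G.neighborFinset v := by
      intro w hw
      simpa using hkv w (List.mem_toFinset.1 hw)
    rw [Finset.length_toList, Finset.card_sdiff_of_subset h1, List.toFinset_card_of_nodup hk,
      card_neighborFinset_eq_degree]
    have := Finset.card_le_card h1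
    rw [List.toFinset_card_of_nodup hk, card_neighborFinset_eq_degree] at this
    omega
  · intro w
    have := hkv w
    simp only [List.mem_append, Finset.mem_toList, Finset.mem_sdiff, List.mem_toFinset,
      mem_neighborFinset]
    tauto

/-- A listing of the vertices in the union of two neighbourhoods of adjacent vertices. -/
lemma exists_neighbor_lists {u v : V} (huv : G.Adj u v) (A : List V) (hA : A.Nodup)
    (hAuv : ∀ w, w ∈ A ↔ G.Adj u w ∧ G.Adj v w) :
    ∃ B C : List V, (u :: v :: (A ++ B ++ C)).Nodup ∧ A.length + B.length + 1 = G.degree u ∧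
      A.length + C.length + 1 = G.degree v ∧ (∀ w, G.Adj u w ↔ w ∈ v :: (A ++ B)) ∧
      (∀ w, G.Adj v w ↔ w ∈ u :: (A ++ C)) ∧
      (G.IsNearClique u → ∀ b ∈ B, ∀ x ∈ A, G.Adj b x) ∧
      (G.IsNearClique v → ∀ c ∈ C, ∀ x ∈ A, G.Adj c x) := by
  have hvA : v ∉ A := fun h => ((hAuv v).1 h).2.ne rfl
  have huA : u ∉ A := fun h => ((hAuv u).1 h).1.ne rfl
  obtain ⟨B, hB, hBl, hBm⟩ := exists_neighbor_list_append u (v :: A)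
    (List.nodup_cons.2 ⟨hvA, hA⟩) (by
      intro w hw
      rcases List.mem_cons.1 hw with rfl | hw
      · exact huv
      · exact ((hAuv w).1 hw).1)
  obtain ⟨C, hC, hCl, hCm⟩ := exists_neighbor_list_append v (u :: A)
    (List.nodup_cons.2 ⟨huA, hA⟩) (by
      intro w hw
      rcases List.mem_cons.1 hw with rfl | hw
      · exact huv.symm
      · exact ((hAuv w).1 hw).2)
  have hB' := hB
  have hC' := hC
  simp only [List.cons_append, List.nodup_cons, List.nodup_append', List.mem_cons,
    List.mem_append, not_or] at hB' hC'
  have hbv : ∀ b ∈ B, b ≠ v := fun b hb h => hB'.2.1.2 (h ▸ hb)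
  have hcu : ∀ c ∈ C, c ≠ u := fun c hc h => hC'.2.1.2 (h ▸ hc)
  have hvB : ∀ b ∈ B, ¬ G.Adj v b := fun b hb h =>
    hB'.2.2.2.2 ((hAuv b).2 ⟨(hBm b).2 (by simp [hb]), h⟩) hb
  have huC : ∀ c ∈ C, ¬ G.Adj u c := fun c hc h =>
    hC'.2.2.2.2 ((hAuv c).2 ⟨h, (hCm c).2 (by simp [hc])⟩) hc
  refine ⟨B, C, ?_, by simp at hBl; omega, by simp at hCl; omega, hBm, hCm, ?_, ?_⟩
  · have hBC : ∀ w ∈ B, w ∉ C := fun w hw hw' => huC w hw' ((hBm w).2 (by simp [hw]))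
    have hvC : v ∉ C := fun h => hC'.1.2.2 h
    have huB : u ∉ B := fun h => hB'.1.2.2 h
    simp only [List.nodup_cons, List.nodup_append', List.mem_cons,
      List.mem_append, List.disjoint_left, not_or]
    refine ⟨⟨huv.ne, ⟨huA, huB⟩, fun h => hcu u h rfl⟩, ⟨⟨hvA, fun h => hbv v h rfl⟩, hvC⟩,
      ⟨hA, hB'.2.2.2.1, fun w h h' => hB'.2.2.2.2 h h'⟩, hC'.2.2.2.1, ?_⟩
    rintro w (hw | hw) hw'
    · exact hC'.2.2.2.2 hw hw'
    · exact hBC w hw hw'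
  · exact fun hu b hb x hx => hu.adj_of_common huv ((hBm b).2 (by simp [hb])) (hvB b hb)
      (hbv b hb) ((hAuv x).1 hx)
  · exact fun hv c hc x hx => hv.adj_of_common huv.symm ((hCm c).2 (by simp [hc])) (huC c hc)
      (hcu c hc) ((hAuv x).1 hx).symm

namespace IsTuzaTight

/-- The neighbours of `v` do not consist of a nonempty independent set `I`, a set `K` that is not
larger than `I`, and a set `R` without edges to `I`. -/
lemma false_of_crown (hG : G.IsTuzaTight) {v : V} (I K R : List V)
    (hv : ∀ w, G.Adj v w ↔ w ∈ I ++ K ++ R) (hI : I.Nodup) (hne : I ≠ [])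
    (hN : ∀ a ∈ I, ∀ b ∈ I ++ R, ¬ G.Adj a b) (hcard : K.length ≤ I.length) : False := by
  have h1 := hG.card_lt_of_independent v I.toFinset (by simpa using hne)
    (fun a ha => (hv a).2 (by simp_all))
    (fun a ha b hb => hN a (List.mem_toFinset.1 ha) b (by simp_all))
  have h2 : (I.toFinset.biUnion fun a => G.neighborFinset v ∩ G.neighborFinset a) ⊆
      K.toFinset := by
    intro w hw
    simp only [Finset.mem_biUnion, List.mem_toFinset, Finset.mem_inter,
      mem_neighborFinset] at hw ⊢
    obtain ⟨a, ha, hvw, haw⟩ := hw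
    have h3 := (hv w).1 hvw
    have h4 := hN a ha w
    simp only [List.mem_append] at h3 h4
    tauto
  have h3 := Finset.card_le_card h2
  have h4 := List.toFinset_card_le K
  rw [List.toFinset_card_of_nodup hI] at h1
  omega

lemma five_le_degree (hG : G.IsTuzaTight) {v : V} (hv : 0 < G.degree v) : 5 ≤ G.degree v := by
  by_contra hlt
  obtain ⟨l, hnd, hl, hm⟩ := exists_neighbor_list_append (G := G) v [] List.nodup_nil (by simp)
  rcases l with _ | ⟨a, _ | ⟨b, _ | ⟨c, _ | ⟨d, _ | ⟨e, l⟩⟩⟩⟩⟩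
  · simp at hl; omega
  · exact hG.false_of_degree_one hnd hm
  · exact hG.false_of_degree_two hnd hm
  · exact hG.false_of_degree_three hnd hm
  · exact hG.false_of_degree_four hnd hm
  · simp at hl; omega

/-- Vertices of degree at most six have near-cliques as neighbourhoods. -/
lemma isNearClique (hG : G.IsTuzaTight) {v : V} (hv : G.degree v ≤ 6) : G.IsNearClique v := by
  intro c a b hc ha hb hca hcb hab
  by_contra! hcon
  obtain ⟨nca, ncb⟩ := hcon
  have h5 := hG.five_le_degree (v := v) ((G.degree_pos_iff_exists_adj v).2 ⟨c, hc⟩)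
  obtain ⟨l, nd, hl, hm⟩ := exists_neighbor_list_append (G := G) v [c, a, b] (by simp [*]) (by simp [*])
  rcases l with _ | ⟨d, _ | ⟨e, _ | ⟨f, _ | ⟨g, l⟩⟩⟩⟩
  · simp at hl; omega
  · simp at hl; omega
  · exact hG.false_of_degree_five nd hm nca ncb
  -- In degree six, split on the neighbours of `c` among the other three vertices: two of them fall
  -- to the certificate, at most one leaves a crown with `I = {c}`.
  · have key : ∀ x y z, [d, e, f].Perm [x, y, z] → G.Adj c x →
        G.Adj c y → False := by
      intro x y z hp hx hy
      exact hG.false_of_degree_six (((hp.append_left [v, c, a, b]).nodup_iff).1 nd)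
        (fun w => (hm w).trans (hp.append_left [c, a, b]).mem_iff) hx hy nca ncb
    have pendant : ∀ x y z, [d, e, f].Perm [x, y, z] → ¬ G.Adj c y → ¬ G.Adj c z → False :=
      fun x y z hp hy hz =>
        hG.false_of_crown [c] [x] [a, b, y, z]
          (fun w => (hm w).trans ((hp.append_left [c, a, b]).mem_iff.trans (by simp; tauto)))
          (by simp) (by simp) (by simp [*]) (by simp)
    have p1 : [d, e, f].Perm [d, f, e] := (List.Perm.swap f e []).cons d
    have p2 : [d, e, f].Perm [e, f, d] := List.perm_append_comm (l₁ := [d]) (l₂ := [e, f])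
    have p3 : [d, e, f].Perm [f, d, e] := List.perm_append_comm (l₁ := [d, e]) (l₂ := [f])
    have k1 := key d e f (List.Perm.refl _)
    have k2 := key d f e p1
    have k3 := key e f d p2
    have q1 := pendant d e f (List.Perm.refl _)
    have q2 := pendant e f d p2
    have q3 := pendant f d e p3
    by_cases hd : G.Adj c d
    · by_cases he : G.Adj c e
      · exact k1 hd he
      · by_cases hf : G.Adj c f
        · exact k2 hd hf
        · exact q1 he hf
    · by_cases he : G.Adj c e
      · by_cases hf : G.Adj c f
        · exact k3 he hf
        · exact q2 hf hd
      · exact q3 hd he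
  · simp at hl; omega

end IsTuzaTight

end SimpleGraph

/-! ### Paths and 4-cycles in near-cliques -/

namespace SimpleGraph

variable {V : Type*} {G : SimpleGraph V}

/-- The non-edges form a matching, so there is at most one; `z` is chosen off it. -/
lemma exists_labelling_three {A : List V} (hA : A.Nodup) (hlen : A.length = 3)
    (h : ∀ a ∈ A, ∀ b ∈ A, ∀ c ∈ A, a ≠ b → a ≠ c → b ≠ c → G.Adj a b ∨ G.Adj a c) :
    ∃ x y z, A.Perm [x, y, z] ∧ G.Adj x z ∧ G.Adj y z := by
  obtain ⟨a, b, c, rfl⟩ := List.length_eq_three.1 hlen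
  obtain ⟨⟨hab, hac⟩, hbc⟩ : (a ≠ b ∧ a ≠ c) ∧ b ≠ c := by simpa using hA
  have ha := h a (by simp) b (by simp) c (by simp) hab hac hbc
  have hb := h b (by simp) a (by simp) c (by simp) hab.symm hbc hac
  have hc := h c (by simp) a (by simp) b (by simp) hac.symm hbc.symm hab
  have p1 : [a, b, c].Perm [a, c, b] := (List.Perm.swap c b []).cons a
  have p2 : [a, b, c].Perm [b, c, a] := List.perm_append_comm (l₁ := [a]) (l₂ := [b, c])
  by_cases h1 : G.Adj a c
  · by_cases h2 : G.Adj b c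
    · exact ⟨a, b, c, .refl _, h1, h2⟩
    · exact ⟨b, c, a, p2, hb.resolve_right h2, h1.symm⟩
  · exact ⟨a, c, b, p1, ha.resolve_right h1, (hc.resolve_left fun h => h1 h.symm)⟩

/-- The non-edges form a matching, so they fit on the diagonals `xt` and `yz` of a 4-cycle `x y t
z`. A non-neighbour of `a` is taken as its opposite vertex; if there is none, a path on the other
three vertices is closed up by `a`. -/
lemma exists_labelling_four {A : List V} (hA : A.Nodup) (hlen : A.length = 4)
    (h : ∀ a ∈ A, ∀ b ∈ A, ∀ c ∈ A, a ≠ b → a ≠ c → b ≠ c → G.Adj a b ∨ G.Adj a c) :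
    ∃ x y z t, A.Perm [x, y, z, t] ∧ G.Adj x y ∧ G.Adj x z ∧ G.Adj y t ∧ G.Adj z t := by
  obtain ⟨a, b, c, d, rfl⟩ := List.length_eq_four.1 hlen
  obtain ⟨⟨hab, hac, had⟩, ⟨hbc, hbd⟩, hcd⟩ :
      (a ≠ b ∧ a ≠ c ∧ a ≠ d) ∧ (b ≠ c ∧ b ≠ d) ∧ c ≠ d := by simpa using hA
  have diag : ∀ p q r s, [a, b, c, d].Perm [p, q, r, s] → ¬ G.Adj p s →
      ∃ x y z t, [a, b, c, d].Perm [x, y, z, t] ∧ G.Adj x y ∧ G.Adj x z ∧ G.Adj y t ∧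
        G.Adj z t := by
    intro p q r s hp hps
    have hmem : ∀ w, w = p ∨ w = q ∨ w = r ∨ w = s → w ∈ [a, b, c, d] := fun w hw =>
      hp.mem_iff.2 (by simpa using hw)
    obtain ⟨⟨hpq, hpr, hps'⟩, ⟨hqr, hqs⟩, hrs⟩ :
        (p ≠ q ∧ p ≠ r ∧ p ≠ s) ∧ (q ≠ r ∧ q ≠ s) ∧ r ≠ s := by
      simpa using hp.nodup_iff.1 hA
    have key : ∀ v w, v ∈ [a, b, c, d] → w ∈ [a, b, c, d] → ∀ u ∈ [a, b, c, d], v ≠ w →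
        v ≠ u → w ≠ u → ¬ G.Adj v w → G.Adj v u :=
      fun v w hv hw u hu h1 h2 h3 h4 => (h v hv w hw u hu h1 h2 h3).resolve_left h4
    have ip := hmem p (by simp)
    have iq := hmem q (by simp)
    have ir := hmem r (by simp)
    have is := hmem s (by simp)
    have hsp : ¬ G.Adj s p := fun h => hps h.symm
    exact ⟨p, q, r, s, hp, key p s ip is q iq hps' hpq hqs.symm hps,
      key p s ip is r ir hps' hpr hrs.symm hps, (key s p is ip q iq hps'.symm hqs.symm hpq hsp).symm,
      (key s p is ip r ir hps'.symm hrs.symm hpr hsp).symm⟩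
  by_cases hb : G.Adj a b
  · by_cases hc : G.Adj a c
    · by_cases hd : G.Adj a d
      · obtain ⟨x, y, z, hp, hxz, hyz⟩ := exists_labelling_three (G := G) (A := [b, c, d])
          (List.nodup_cons.1 hA).2 rfl fun p hp q hq r hr =>
            h p (List.mem_cons_of_mem _ hp) q (List.mem_cons_of_mem _ hq) r
              (List.mem_cons_of_mem _ hr)
        have hax : ∀ w ∈ [x, y, z], G.Adj a w := by
          intro w hw
          have := hp.mem_iff.2 hw
          simp only [List.mem_cons, List.not_mem_nil, or_false] at this
          rcases this with rfl | rfl | rfl <;> assumption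
        exact ⟨a, x, y, z, hp.cons a, hax x (by simp), hax y (by simp), hxz, hyz⟩
      · exact diag a b c d (.refl _) hd
    · exact diag a b d c (((List.Perm.swap d c []).cons b).cons a) hc
  · exact diag a c d b ((List.perm_append_comm (l₁ := [b]) (l₂ := [c, d])).cons a) hb

lemma exists_perm_three [DecidableEq V] {A : List V} (hA : A.length = 3) {x : V} (hx : x ∈ A) :
    ∃ y z, A.Perm [x, y, z] := by
  obtain ⟨y, z, hyz⟩ := List.length_eq_two.1
    (by rw [List.length_erase_of_mem hx]; omega : (A.erase x).length = 2)
  exact ⟨y, z, hyz ▸ List.perm_cons_erase hx⟩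

variable [Fintype V] [DecidableEq V] [DecidableRel G.Adj]

/-- A vertex with near-clique neighbourhood has at most one neighbour other than `v` that is not
adjacent to its neighbour `v`. -/
lemma IsNearClique.degree_le {u v : V} (hu : G.IsNearClique u) (huv : G.Adj u v) {A : List V}
    (hA : A.Nodup) (hAuv : ∀ w, w ∈ A ↔ G.Adj u w ∧ G.Adj v w) :
    G.degree u ≤ A.length + 2 := by
  obtain ⟨B, C, hnd, hB, -, hmB, -, -, -⟩ := exists_neighbor_lists huv A hA hAuv
  by_contra! hlt
  match B, (by omega : 2 ≤ B.length) with
  | b :: b' :: B, _ =>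
    have hb := (hmB b).2 (by simp)
    have hb' := (hmB b').2 (by simp)
    simp only [List.nodup_cons, List.mem_cons, List.mem_append, List.nodup_append',
      not_or] at hnd
    obtain ⟨-, ⟨⟨-, hvb, hvb', -⟩, -⟩, ⟨-, ⟨⟨hbb, -⟩, -⟩, hdis⟩, -⟩ := hnd
    rcases hu v b b' huv hb hb' hvb hvb' hbb with h | h
    · exact hdis ((hAuv b).2 ⟨hb, h⟩) (by simp)
    · exact hdis ((hAuv b').2 ⟨hb', h⟩) (by simp)

lemma exists_common_neighbor_list (u v : V) :
    ∃ A : List V, A.Nodup ∧ ∀ w, w ∈ A ↔ G.Adj u w ∧ G.Adj v w :=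
  ⟨(G.neighborFinset u ∩ G.neighborFinset v).toList, Finset.nodup_toList _, by simp⟩

end SimpleGraph

/-! ### Edges at vertices of degree five and six -/

namespace SimpleGraph

variable {V : Type*} {G : SimpleGraph V} [Fintype V] [DecidableEq V] [DecidableRel G.Adj]

namespace IsTuzaTight

/-- Two vertices of degree at most six are not adjacent. -/
lemma seven_le_degree_of_adj (hG : G.IsTuzaTight) {u v : V} (huv : G.Adj u v)
    (hu : G.degree u ≤ 6) : 7 ≤ G.degree v := by
  by_contra! hv
  wlog hle : G.degree u ≤ G.degree v generalizing u v
  · exact this huv.symm (by omega) (by omega) (by omega)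
  have nu := hG.isNearClique hu
  have nv := hG.isNearClique (v := v) (by omega)
  have hu5 := hG.five_le_degree ((G.degree_pos_iff_exists_adj u).2 ⟨v, huv⟩)
  obtain ⟨A, hA, hAm⟩ := exists_common_neighbor_list (G := G) u v
  have hdu := nu.degree_le huv hA hAm
  have hdv := nv.degree_le huv.symm hA (by simpa [and_comm] using hAm)
  have hAu : ∀ w ∈ A, G.Adj u w := fun w hw => ((hAm w).1 hw).1
  have hnear : ∀ a ∈ A, ∀ b ∈ A, ∀ c ∈ A, a ≠ b → a ≠ c → b ≠ c → G.Adj a b ∨ G.Adj a c :=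
    fun a ha b hb c hc => nu a b c (hAu a ha) (hAu b hb) (hAu c hc)
  obtain ⟨_, _, -, hA1, hA2, -⟩ := exists_neighbor_lists huv A hA hAm
  -- Each endpoint has degree `|A| + 1` or `|A| + 2`. Hence three common neighbours force degrees 5,
  -- 5 and five force 6, 6.
  obtain hA3 | hA4 | hA5 : A.length = 3 ∨ A.length = 4 ∨ A.length = 5 := by omega
  · obtain ⟨x, y, z, hp, hxz, hyz⟩ := exists_labelling_three hA hA3 hnear
    obtain ⟨B, C, nd, hB, hC, hmu, hmv, hb, hc⟩ := exists_neighbor_lists huv _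
      (hp.nodup_iff.1 hA) fun w => hp.mem_iff.symm.trans (hAm w)
    simp only [List.length_cons, List.length_nil] at hB hC
    obtain ⟨b, rfl⟩ := List.length_eq_one_iff.1 (by omega : B.length = 1)
    obtain ⟨c, rfl⟩ := List.length_eq_one_iff.1 (by omega : C.length = 1)
    have hb := hb nu b (by simp)
    have hc := hc nv c (by simp)
    exact hG.false_of_adj_five_five nd hmu hmv hxz hyz (hb x (by simp)) (hb y (by simp))
      (hb z (by simp)) (hc x (by simp)) (hc y (by simp)) (hc z (by simp))
  · obtain ⟨x, y, z, t, hp, hxy, hxz, hyt, hzt⟩ := exists_labelling_four hA hA4 hnear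
    obtain ⟨B, C, nd, hB, hC, hmu, hmv, hb, hc⟩ := exists_neighbor_lists huv _
      (hp.nodup_iff.1 hA) fun w => hp.mem_iff.symm.trans (hAm w)
    simp only [List.length_cons, List.length_nil] at hB hC
    obtain h5 | h6 : G.degree u = 5 ∨ G.degree u = 6 := by omega
    · obtain rfl := List.length_eq_zero_iff.1 (by omega : B.length = 0)
      obtain h5' | h6' : G.degree v = 5 ∨ G.degree v = 6 := by omega
      · obtain rfl := List.length_eq_zero_iff.1 (by omega : C.length = 0)
        exact hG.false_of_adj_five_five_twins nd hmu hmv hxy hxz hyt hzt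
      · obtain ⟨c, rfl⟩ := List.length_eq_one_iff.1 (by omega : C.length = 1)
        exact hG.false_of_adj_five_six nd hmu hmv hxy hxz hyt hzt
    · obtain ⟨b, rfl⟩ := List.length_eq_one_iff.1 (by omega : B.length = 1)
      obtain ⟨c, rfl⟩ := List.length_eq_one_iff.1 (by omega : C.length = 1)
      have hb := hb nu b (by simp)
      have hc := hc nv c (by simp)
      exact hG.false_of_adj_six_six nd hmu hmv hxy hxz hyt hzt (hb x (by simp)) (hb y (by simp))
        (hb z (by simp)) (hb t (by simp)) (hc x (by simp)) (hc y (by simp)) (hc z (by simp))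
        (hc t (by simp))
  · obtain ⟨s, A, rfl⟩ := List.exists_cons_of_length_eq_add_one hA5
    obtain ⟨x, y, z, t, hp, hxy, hxz, hyt, hzt⟩ := exists_labelling_four (G := G) hA.of_cons
      (by simpa using hA5) fun a ha b hb c hc => hnear a (by simp [ha]) b (by simp [hb]) c
        (by simp [hc])
    have hp' : (s :: A).Perm [x, y, z, t, s] :=
      (hp.cons s).trans (List.perm_append_comm (l₁ := [s]) (l₂ := [x, y, z, t]))
    obtain ⟨B, C, nd, hB, hC, hmu, hmv, hb, hc⟩ := exists_neighbor_lists huv _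
      (hp'.nodup_iff.1 hA) fun w => hp'.mem_iff.symm.trans (hAm w)
    simp only [List.length_cons, List.length_nil] at hB hC
    obtain rfl := List.length_eq_zero_iff.1 (by omega : B.length = 0)
    obtain rfl := List.length_eq_zero_iff.1 (by omega : C.length = 0)
    exact hG.false_of_adj_six_six_twins nd hmu hmv hxy hxz hyt hzt

/-- A vertex of degree six is not adjacent to a vertex of degree seven. -/
lemma degree_ne_seven_of_adj (hG : G.IsTuzaTight) {u v : V} (huv : G.Adj u v)
    (hu : G.degree u = 6) : G.degree v ≠ 7 := by
  intro hv
  have nu := hG.isNearClique hu.le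
  obtain ⟨A, hA, hAm⟩ := exists_common_neighbor_list (G := G) u v
  have hdu := nu.degree_le huv hA hAm
  have hAu : ∀ w ∈ A, G.Adj u w := fun w hw => ((hAm w).1 hw).1
  have hnear : ∀ a ∈ A, ∀ b ∈ A, ∀ c ∈ A, a ≠ b → a ≠ c → b ≠ c → G.Adj a b ∨ G.Adj a c :=
    fun a ha b hb c hc => nu a b c (hAu a ha) (hAu b hb) (hAu c hc)
  obtain ⟨_, _, -, hA1, hA2, -⟩ := exists_neighbor_lists huv A hA hAm
  obtain hA4 | hA5 : A.length = 4 ∨ A.length = 5 := by omega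
  · obtain ⟨x, y, z, t, hp, hxy, hxz, hyt, hzt⟩ := exists_labelling_four hA hA4 hnear
    obtain ⟨B, C, nd, hB, hC, hmu, hmv, hb, -⟩ := exists_neighbor_lists huv _
      (hp.nodup_iff.1 hA) fun w => hp.mem_iff.symm.trans (hAm w)
    simp only [List.length_cons, List.length_nil] at hB hC
    obtain ⟨b, rfl⟩ := List.length_eq_one_iff.1 (by omega : B.length = 1)
    obtain ⟨c, d, rfl⟩ := List.length_eq_two.1 (by omega : C.length = 2)
    have hb := hb nu b (by simp)
    exact hG.false_of_adj_six_seven nd hmu hmv hxy hxz hyt hzt (hb x (by simp)) (hb y (by simp))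
      (hb z (by simp)) (hb t (by simp))
  · obtain ⟨s, A, rfl⟩ := List.exists_cons_of_length_eq_add_one hA5
    obtain ⟨x, y, z, t, hp, hxy, hxz, hyt, hzt⟩ := exists_labelling_four (G := G) hA.of_cons
      (by simpa using hA5) fun a ha b hb c hc => hnear a (by simp [ha]) b (by simp [hb]) c
        (by simp [hc])
    have hp' : (s :: A).Perm [x, y, z, t, s] :=
      (hp.cons s).trans (List.perm_append_comm (l₁ := [s]) (l₂ := [x, y, z, t]))
    obtain ⟨B, C, nd, hB, hC, hmu, hmv, -, -⟩ := exists_neighbor_lists huv _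
      (hp'.nodup_iff.1 hA) fun w => hp'.mem_iff.symm.trans (hAm w)
    simp only [List.length_cons, List.length_nil] at hB hC
    obtain rfl := List.length_eq_zero_iff.1 (by omega : B.length = 0)
    obtain ⟨c, rfl⟩ := List.length_eq_one_iff.1 (by omega : C.length = 1)
    exact hG.false_of_adj_six_seven_dominated nd hmu hmv hxy hxz hyt hzt

/-- The number of neighbours of degree at most six exceeds `G.degree w - 7` for at most two of the
neighbours `w` of a vertex of degree five with a neighbour of degree seven. -/
lemma exists_three_of_adj_five_seven (hG : G.IsTuzaTight) {u v : V} (huv : G.Adj u v)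
    (hu : G.degree u = 5) (hv : G.degree v = 7) :
    ∃ W : Finset V, W.card = 3 ∧ ∀ w ∈ W, G.Adj u w ∧
      ((G.neighborFinset w).filter fun x => G.degree x ≤ 6).card + 7 ≤ G.degree w := by
  have nu := hG.isNearClique (v := u) (by omega)
  obtain ⟨A, hA, hAm⟩ := exists_common_neighbor_list (G := G) u v
  have hdu := nu.degree_le huv hA hAm
  have hAu : ∀ w ∈ A, G.Adj u w := fun w hw => ((hAm w).1 hw).1
  have hnear : ∀ a ∈ A, ∀ b ∈ A, ∀ c ∈ A, a ≠ b → a ≠ c → b ≠ c → G.Adj a b ∨ G.Adj a c :=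
    fun a ha b hb c hc => nu a b c (hAu a ha) (hAu b hb) (hAu c hc)
  obtain ⟨_, _, -, hA1, hA2, -⟩ := exists_neighbor_lists huv A hA hAm
  obtain hA3 | hA4 : A.length = 3 ∨ A.length = 4 := by omega
  swap
  · exfalso
    obtain ⟨x, y, z, t, hp, hxy, hxz, hyt, hzt⟩ := exists_labelling_four hA hA4 hnear
    obtain ⟨B, C, nd, hB, hC, hmu, hmv, -, -⟩ := exists_neighbor_lists huv _
      (hp.nodup_iff.1 hA) fun w => hp.mem_iff.symm.trans (hAm w)
    simp only [List.length_cons, List.length_nil] at hB hC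
    obtain rfl := List.length_eq_zero_iff.1 (by omega : B.length = 0)
    obtain ⟨c, d, rfl⟩ := List.length_eq_two.1 (by omega : C.length = 2)
    exact hG.false_of_adj_five_seven_dominated nd hmu hmv hxy hxz hyt hzt
  obtain ⟨B, C, nd, hB, hC, hmu, hmv, hb, -⟩ := exists_neighbor_lists huv A hA hAm
  obtain ⟨b, rfl⟩ := List.length_eq_one_iff.1 (by omega : B.length = 1)
  have hC3 : C.length = 3 := by omega
  have hb : ∀ x ∈ A, G.Adj b x := hb nu b (by simp)
  have nd' : ∀ {A' C' : List V}, A.Perm A' → C.Perm C' → (u :: v :: (A' ++ [b] ++ C')).Nodup :=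
    fun hA' hC' => ((((hA'.append_right [b]).append hC').cons v).cons u).nodup_iff.1 nd
  have hmu' : ∀ {A' : List V}, A.Perm A' → ∀ w, G.Adj u w ↔ w ∈ v :: (A' ++ [b]) :=
    fun hA' w => (hmu w).trans ((hA'.append_right [b]).cons v).mem_iff
  have hmv' : ∀ {A' C' : List V}, A.Perm A' → C.Perm C' →
      ∀ w, G.Adj v w ↔ w ∈ u :: (A' ++ C') :=
    fun hA' hC' w => (hmv w).trans ((hA'.append hC').cons u).mem_iff
  obtain ⟨c₀, d₀, e₀, hC0⟩ := List.length_eq_three.1 hC3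
  have hC0 : C.Perm [c₀, d₀, e₀] := by rw [hC0]
  have memA : ∀ {x y z}, A.Perm [x, y, z] → x ∈ A ∧ y ∈ A ∧ z ∈ A := fun hp =>
    ⟨hp.mem_iff.2 (by simp), hp.mem_iff.2 (by simp), hp.mem_iff.2 (by simp)⟩
  have hAA : ∀ p ∈ A, ∀ q ∈ A, p ≠ q → G.Adj p q := by
    obtain ⟨x, y, z, hp, hxz, hyz⟩ := exists_labelling_three hA hA3 hnear
    obtain ⟨hx, hy, hz⟩ := memA hp
    have hxy : G.Adj x y := by
      by_contra nxy
      exact hG.adj_of_adj_five_seven (nd' hp hC0) (hmu' hp) (hmv' hp hC0) hxz hyz (hb x hx)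
        (hb y hy) (hb z hz) nxy
    intro p hp' q hq' hpq
    rw [hp.mem_iff] at hp' hq'
    simp only [List.mem_cons, List.not_mem_nil, or_false] at hp' hq'
    rcases hp' with rfl | rfl | rfl <;> rcases hq' with rfl | rfl | rfl <;>
      first | exact absurd rfl hpq | assumption | (apply Adj.symm; assumption)
  have pairA : ∀ {x y z}, A.Perm [x, y, z] → G.Adj x y ∧ G.Adj x z ∧ G.Adj y z := by
    intro x y z hp
    obtain ⟨hx, hy, hz⟩ := memA hp
    obtain ⟨⟨hxy, hxz⟩, hyz⟩ : (x ≠ y ∧ x ≠ z) ∧ y ≠ z := by simpa using hp.nodup_iff.1 hA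
    exact ⟨hAA x hx y hy hxy, hAA x hx z hz hxz, hAA y hy z hz hyz⟩
  have hAC : ∀ x ∈ A, ∀ c ∈ C, G.Adj x c := by
    intro x hx c hc
    by_contra nxc
    obtain ⟨y, z, hp⟩ := exists_perm_three hA3 hx
    obtain ⟨d, e, hq⟩ := exists_perm_three hC3 hc
    obtain ⟨hxy, hxz, hyz⟩ := pairA hp
    obtain ⟨hx, hy, hz⟩ := memA hp
    exact hG.adj_outer_of_adj_five_seven (nd' hp hq) (hmu' hp) (hmv' hp hq) hxy hxz hyz (hb x hx)
      (hb y hy) (hb z hz) nxc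
  have hCC : ∀ {c d e}, C.Perm [c, d, e] → G.Adj c d := by
    intro c d e hq
    by_contra ncd
    obtain ⟨x, y, z, rfl⟩ := List.length_eq_three.1 hA3
    obtain ⟨hxy, hxz, hyz⟩ := pairA (.refl _)
    have hmem : c ∈ C ∧ d ∈ C ∧ e ∈ C :=
      ⟨hq.mem_iff.2 (by simp), hq.mem_iff.2 (by simp), hq.mem_iff.2 (by simp)⟩
    have h : ∀ a ∈ [x, y, z], G.Adj c a ∧ G.Adj d a ∧ G.Adj e a := fun a ha =>
      ⟨(hAC a ha c hmem.1).symm, (hAC a ha d hmem.2.1).symm, (hAC a ha e hmem.2.2).symm⟩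
    have hx := h x (by simp)
    have hy := h y (by simp)
    have hz := h z (by simp)
    exact hG.outer_adj_of_adj_five_seven (nd' (.refl _) hq) (hmu' (.refl _)) (hmv' (.refl _) hq)
      hxy hxz hyz (hb x (by simp)) (hb y (by simp)) (hb z (by simp)) hx.1 hy.1 hz.1 hx.2.1 hy.2.1
      hz.2.1 hx.2.2 hy.2.2 hz.2.2 ncd
  -- The clique structure gives `c` the six neighbours `v, x, y, z, d, e`, and degree exactly six is
  -- impossible next to `v`, of degree seven.
  have hCdeg : ∀ c ∈ C, 7 ≤ G.degree c := by
    intro c hc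
    by_contra! hlt
    obtain ⟨d, e, hq⟩ := exists_perm_three hC3 hc
    have hvc : G.Adj v c := (hmv c).2 (by simp [hc])
    have hce : G.Adj c e := hCC (hq.trans ((List.Perm.swap e d []).cons c))
    obtain ⟨x, y, z, rfl⟩ := List.length_eq_three.1 hA3
    obtain ⟨l, -, hl, -⟩ := exists_neighbor_list_append (G := G) c [v, x, y, z, d, e]
      ((nd' (.refl _) hq).sublist (.cons u (.cons_cons v (.cons_cons x (.cons_cons y
        (.cons_cons z (.cons b (.cons c (.refl _)))))))))
      (by
        have := hAC x (by simp) c hc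
        have := hAC y (by simp) c hc
        have := hAC z (by simp) c hc
        have := hCC hq
        simp [*, G.adj_comm c v, G.adj_comm c x, G.adj_comm c y, G.adj_comm c z])
    simp only [List.length_cons, List.length_nil] at hl
    exact hG.degree_ne_seven_of_adj hvc.symm (by omega) hv
  refine ⟨A.toFinset, by rw [List.toFinset_card_of_nodup hA, hA3], ?_⟩
  intro x hx
  rw [List.mem_toFinset] at hx
  refine ⟨hAu x hx, ?_⟩
  obtain ⟨y, z, hp⟩ := exists_perm_three hA3 hx
  obtain ⟨hxy, hxz, -⟩ := pairA hp
  obtain ⟨-, hy, hz⟩ := memA hp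
  have hdeg : ∀ w, G.Adj u w → 7 ≤ G.degree w := fun w hw =>
    hG.seven_le_degree_of_adj hw (by omega)
  -- Seven neighbours of `x` that are not low: `v`, the other neighbours `y, z, b` of the low vertex
  -- `u`, and the three vertices of `C`. So at most `G.degree x - 7` neighbours are low.
  have hK : ∀ k ∈ v :: y :: z :: b :: C, G.Adj x k ∧ 7 ≤ G.degree k := by
    intro k hk
    simp only [List.mem_cons] at hk
    rcases hk with rfl | rfl | rfl | rfl | hk
    · exact ⟨((hAm x).1 hx).2.symm, hv.ge⟩
    · exact ⟨hxy, hdeg _ (hAu _ hy)⟩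
    · exact ⟨hxz, hdeg _ (hAu _ hz)⟩
    · exact ⟨(hb x hx).symm, hdeg _ ((hmu _).2 (by simp))⟩
    · exact ⟨hAC x hx k hk, hCdeg k hk⟩
  obtain ⟨l, -, hl, hm⟩ := exists_neighbor_list_append (G := G) x (v :: y :: z :: b :: C)
    ((nd' hp (.refl _)).sublist (.cons u (.cons_cons v (.cons x (.refl _)))))
    fun k hk => (hK k hk).1
  have hsub : ((G.neighborFinset x).filter fun w => G.degree w ≤ 6) ⊆ l.toFinset := by
    intro w hw
    rw [Finset.mem_filter, mem_neighborFinset] at hw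
    rcases List.mem_append.1 ((hm w).1 hw.1) with h | h
    · have := (hK w h).2
      omega
    · exact List.mem_toFinset.2 h
  have := (Finset.card_le_card hsub).trans l.toFinset_card_le
  simp only [List.length_cons] at hl
  omega

end IsTuzaTight

end SimpleGraph

/-! ### Vertices of degree eight -/

namespace SimpleGraph

variable {V : Type*} {G : SimpleGraph V} [Fintype V] [DecidableEq V] [DecidableRel G.Adj]

lemma exists_neighbor_list_of_degree_eq_five {u : V} (hu : G.degree u = 5) {k : List V}
    (hk : k.Nodup) (hlen : k.length = 4) (hku : ∀ w ∈ k, G.Adj u w) :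
    ∃ m, (u :: (k ++ [m])).Nodup ∧ ∀ w, G.Adj u w ↔ w ∈ k ++ [m] := by
  obtain ⟨l, nd, hl, hm⟩ := exists_neighbor_list_append u k hk hku
  obtain ⟨m, rfl⟩ := List.length_eq_one_iff.1 (by omega : l.length = 1)
  exact ⟨m, nd, hm⟩

lemma adj_iff_mem_of_degree_eq_five {u : V} (hu : G.degree u = 5) {k : List V}
    (hk : k.Nodup) (hlen : k.length = 5) (hku : ∀ w ∈ k, G.Adj u w) (w : V) :
    G.Adj u w ↔ w ∈ k := by
  obtain ⟨l, nd, hl, hm⟩ := exists_neighbor_list_append u k hk hku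
  obtain rfl := List.length_eq_zero_iff.1 (by omega : l.length = 0)
  simpa using hm w

namespace IsTuzaTight

/-- A vertex of degree five is adjacent to at least three neighbours of each of its neighbours. -/
lemma three_le_length_of_common (hG : G.IsTuzaTight) {u v : V} (huv : G.Adj u v)
    (hu : G.degree u = 5) {l : List V} (hl : ∀ w, G.Adj u w → G.Adj v w → w ∈ l) :
    3 ≤ l.length := by
  obtain ⟨A, hA, hAm⟩ := exists_common_neighbor_list (G := G) u v
  have h1 := (hG.isNearClique (v := u) (by omega)).degree_le huv hA hAm
  have h2 := (hA.subperm fun w hw => hl w ((hAm w).1 hw).1 ((hAm w).1 hw).2).length_le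
  omega

/-- Among the neighbours of a vertex of degree eight, each common neighbour is adjacent to
two out of three vertices of degree five. -/
lemma adj_or_adj_of_degree_eq_eight (hG : G.IsTuzaTight) {v p q r x : V} (hv : G.degree v = 8)
    (hp : G.degree p = 5) (hq : G.degree q = 5) (hr : G.degree r = 5)
    (hnd : [p, q, r, x].Nodup) (hvl : ∀ w ∈ [p, q, r, x], G.Adj v w) :
    G.Adj x q ∨ G.Adj x r := by
  by_contra! hcon
  obtain ⟨nxq, nxr⟩ := hcon
  obtain ⟨Y, nd, hY, hm⟩ := exists_neighbor_list_append v _ hnd hvl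
  simp only [List.length_cons, List.length_nil] at hY
  have hY4 : Y.length = 4 := by omega
  have hY' := nd
  simp only [List.nodup_cons, List.cons_append, List.nil_append,
    List.mem_cons, not_or] at hY'
  obtain ⟨-, ⟨hpq, hpr, hpx, hpY⟩, ⟨hqr, hqx, hqY⟩, ⟨hrx, hrY⟩, hxY, hYnd⟩ := hY'
  have low : ∀ {y z}, G.degree y = 5 → G.degree z = 5 → ¬ G.Adj y z := fun hy hz h => by
    have := hG.seven_le_degree_of_adj h (by omega)
    omega
  have npq := low hp hq
  have npr := low hp hr
  have nqr := low hq hr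
  have hvY : ∀ y ∈ Y, G.Adj v y := fun y hy => (hm y).2 (by simp [hy])
  have hvp : G.Adj v p := hvl p (by simp)
  have hvq : G.Adj v q := hvl q (by simp)
  have hvr : G.Adj v r := hvl r (by simp)
  have hvx : G.Adj v x := hvl x (by simp)
  -- Otherwise `p, q, r, x` are independent and the four other neighbours of `v` complete a crown.
  have hpx : G.Adj p x := by
    by_contra npx
    exact hG.false_of_crown [p, q, r, x] Y [] (by simpa using hm) hnd (by simp)
      (by simp [*, G.adj_comm q p, G.adj_comm r p, G.adj_comm r q, G.adj_comm x p,
        G.adj_comm q x, G.adj_comm r x]) (by simp [hY4])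
  have two : ∀ u, G.degree u = 5 → G.Adj v u → ¬ G.Adj u x → ¬ G.Adj u p → ¬ G.Adj u q →
      ¬ G.Adj u r → ∀ a ∈ Y, ∀ b ∈ Y, a ≠ b → G.Adj u a ∨ G.Adj u b := by
    intro u hu hvu nx np nq nr a ha b hb hab
    by_contra! hcon
    have h := hG.three_le_length_of_common hvu.symm hu (l := (Y.erase a).erase b) (by
      intro w huw hvw
      have hne : ∀ {z}, ¬ G.Adj u z → w ≠ z := fun hz h => hz (h ▸ huw)
      have hw := (hm w).1 hvw
      simp only [List.mem_append, List.mem_cons, List.not_mem_nil, or_false, hne nx, hne np,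
        hne nq, hne nr, false_or] at hw
      rw [List.mem_erase_of_ne (hne hcon.2), List.mem_erase_of_ne (hne hcon.1)]
      exact hw)
    rw [List.length_erase_of_mem ((List.mem_erase_of_ne hab.symm).2 hb),
      List.length_erase_of_mem ha] at h
    omega
  have hq2 := two q hq hvq (fun h => nxq h.symm) (fun h => npq h.symm) (fun h => h.ne rfl) nqr
  have hr2 := two r hr hvr (fun h => nxr h.symm) (fun h => npr h.symm) (fun h => nqr h.symm)
    (fun h => h.ne rfl)
  have matching : ∀ x' y z s t, [x', y, z, s, t].Nodup → (∀ w ∈ [x', y, z, s, t], w ∈ x :: Y) →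
      G.Adj p x' → ¬ G.Adj x' q → ¬ G.Adj x' r → G.Adj q y → G.Adj r z → G.Adj s t → False := by
    intro x' y z s t hnd' hsub h1 h2 h3 h4 h5 h6
    have hperm : (x :: Y).Perm [x', y, z, s, t] :=
      ((hnd'.subperm hsub).perm_of_length_le (by simp [hY4])).symm
    exact hG.false_of_degree_eight_of_matching ((hperm.append_left [v, p, q, r]).nodup_iff.1 nd)
      (fun w => (hm w).trans (hperm.append_left [p, q, r]).mem_iff) h1 h4 h5 h6 npq npr nqr h2 h3
  -- `q` misses at most one vertex of `Y`; `l` is that vertex, or arbitrary. The aim is to show that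
  -- `q` and `r` both miss `l`, and that `l` has no neighbour in the rest of `Y`, since any such
  -- edge would complete a forbidden perfect matching of `N(v)`.
  obtain ⟨l, hl, hql⟩ : ∃ l ∈ Y, ∀ w ∈ Y, w ≠ l → G.Adj q w := by
    by_cases h : ∃ l ∈ Y, ¬ G.Adj q l
    · obtain ⟨l, hl, hql⟩ := h
      exact ⟨l, hl, fun w hw hwl => (hq2 w hw l hl hwl).resolve_right hql⟩
    · push Not at h
      obtain ⟨l, hl⟩ := List.exists_mem_of_length_pos (by omega : 0 < Y.length)
      exact ⟨l, hl, fun w hw _ => h w hw⟩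
  obtain ⟨i, j, k, hijk⟩ := List.length_eq_three.1
    (by rw [List.length_erase_of_mem hl]; omega : (Y.erase l).length = 3)
  have hperm : Y.Perm [l, i, j, k] := hijk ▸ List.perm_cons_erase hl
  obtain ⟨⟨hli, hlj, hlk⟩, ⟨hij, hik⟩, hjk⟩ :
      (l ≠ i ∧ l ≠ j ∧ l ≠ k) ∧ (i ≠ j ∧ i ≠ k) ∧ j ≠ k := by
    simpa using hperm.nodup_iff.1 hYnd
  have hi : i ∈ Y := hperm.mem_iff.2 (by simp)
  have hj : j ∈ Y := hperm.mem_iff.2 (by simp)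
  have hk : k ∈ Y := hperm.mem_iff.2 (by simp)
  have hxne : ∀ {w}, w ∈ Y → x ≠ w := fun hw h => hxY (h ▸ hw)
  have hxi := hxne hi
  have hxj := hxne hj
  have hxk := hxne hk
  have hxl := hxne hl
  have hqi := hql i hi hli.symm
  have hqj := hql j hj hlj.symm
  have hqk := hql k hk hlk.symm
  have nrl : ¬ G.Adj r l := by
    intro hrl
    rcases hG.isNearClique (v := q) (by omega) i j k hqi hqj hqk hij hik hjk with h | h
    · exact matching x k l i j (by simp [*, Ne.symm]) (by simp [*]) hpx nxq nxr hqk hrl h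
    · exact matching x j l i k (by simp [*, Ne.symm]) (by simp [*]) hpx nxq nxr hqj hrl h
  have hri := (hr2 i hi l hl hli.symm).resolve_right nrl
  have hrj := (hr2 j hj l hl hlj.symm).resolve_right nrl
  have hrk := (hr2 k hk l hl hlk.symm).resolve_right nrl
  have nql : ¬ G.Adj q l := by
    intro hql
    rcases hG.isNearClique (v := r) (by omega) i j k hri hrj hrk hij hik hjk with h | h
    · exact matching x l k i j (by simp [*, Ne.symm]) (by simp [*]) hpx nxq nxr hql hrk h
    · exact matching x l j i k (by simp [*, Ne.symm]) (by simp [*]) hpx nxq nxr hql hrj h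
  have nli : ¬ G.Adj l i := fun h =>
    matching x j k l i (by simp [*, Ne.symm]) (by simp [*]) hpx nxq nxr hqj hrk h
  have nlj : ¬ G.Adj l j := fun h =>
    matching x i k l j (by simp [*, Ne.symm]) (by simp [*]) hpx nxq nxr hqi hrk h
  have nlk : ¬ G.Adj l k := fun h =>
    matching x i j l k (by simp [*, Ne.symm]) (by simp [*]) hpx nxq nxr hqi hrj h
  have nlq : ¬ G.Adj l q := fun h => nql h.symm
  have nlr : ¬ G.Adj l r := fun h => nrl h.symm
  have hmem : ∀ w, G.Adj v w ↔ w ∈ [p, q, r, x] ++ [l, i, j, k] := fun w =>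
    (hm w).trans (hperm.append_left _).mem_iff
  have hpl : G.Adj p l := by
    by_contra npl
    exact hG.false_of_crown [l] [x] [p, q, r, i, j, k]
      (fun w => (hmem w).trans (by simp [or_comm, or_left_comm])) (by simp) (by simp)
      (by simp [*, G.adj_comm l p]) (by simp)
  -- `p` has three common neighbours with `v`, and outside `i, j, k` only `x` and `l` are available.
  -- As `l` and `w` are not adjacent, the near-clique at `p` makes `xw` an edge, and `pl`, `xw`
  -- extend to a forbidden matching with `l` in the role of `x`.
  obtain ⟨w, hw, hpw⟩ : ∃ w ∈ [i, j, k], G.Adj p w := by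
    by_contra! hcon
    have h := hG.three_le_length_of_common hvp.symm hp (l := [x, l]) (by
      intro w hpw hvw
      have hne : ∀ {z}, ¬ G.Adj p z → w ≠ z := fun hz h => hz (h ▸ hpw)
      have hw := (hmem w).1 hvw
      have h1 := hne (hcon i (by simp))
      have h2 := hne (hcon j (by simp))
      have h3 := hne (hcon k (by simp))
      have h4 := hne npq
      have h5 := hne npr
      simpa [h1, h2, h3, h4, h5, hpw.ne'] using hw)
    simp at h
  have nlw : ¬ G.Adj l w := by
    simp only [List.mem_cons, List.not_mem_nil, or_false] at hw
    rcases hw with rfl | rfl | rfl <;> assumption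
  have hxw : G.Adj x w := by
    have hwl : w ≠ l := by
      simp only [List.mem_cons, List.not_mem_nil, or_false] at hw
      rcases hw with rfl | rfl | rfl <;> exact Ne.symm (by assumption)
    have hxw : x ≠ w := by
      simp only [List.mem_cons, List.not_mem_nil, or_false] at hw
      rcases hw with rfl | rfl | rfl <;> assumption
    exact ((hG.isNearClique (v := p) (by omega) w l x hpw hpl hpx hwl hxw.symm
      hxl.symm).resolve_left fun h => nlw h.symm).symm
  simp only [List.mem_cons, List.not_mem_nil, or_false] at hw
  rcases hw with rfl | rfl | rfl
  · exact matching l j k x w (by simp [*, Ne.symm]) (by simp [*]) hpl nlq nlr hqj hrk hxw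
  · exact matching l i k x w (by simp [*, Ne.symm]) (by simp [*]) hpl nlq nlr hqi hrk hxw
  · exact matching l i j x w (by simp [*, Ne.symm]) (by simp [*]) hpl nlq nlr hqi hrj hxw

end IsTuzaTight

end SimpleGraph

namespace SimpleGraph

variable {V : Type*} {G : SimpleGraph V} [Fintype V] [DecidableEq V] [DecidableRel G.Adj]

namespace IsTuzaTight

/-- Since `r` sees both `d` and `e`, only the pairs `pd` and `qe` are open. `hde` leaves out the
case that only `pd` is an edge, which is the mirror image of only `qe` being one. -/
lemma false_of_degree_eight_of_three_misses_aux (hG : G.IsTuzaTight) {v p q r a b c d e : V}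
    (hp : G.degree p = 5) (hq : G.degree q = 5) (hr : G.degree r = 5)
    (nd : [v, p, q, r, a, b, c, d, e].Nodup)
    (hv : ∀ w, G.Adj v w ↔ w ∈ [p, q, r, a, b, c, d, e])
    (npa : ¬ G.Adj p a) (nqb : ¬ G.Adj q b) (nrc : ¬ G.Adj r c)
    (hpb : G.Adj p b) (hpc : G.Adj p c) (hqa : G.Adj q a) (hqc : G.Adj q c)
    (hra : G.Adj r a) (hrb : G.Adj r b)
    (hqd : G.Adj q d) (hrd : G.Adj r d) (hpe : G.Adj p e) (hre : G.Adj r e)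
    (hde : G.Adj p d → G.Adj q e) : False := by
  have np := hG.isNearClique (v := p) (by omega)
  have nq := hG.isNearClique (v := q) (by omega)
  have nr := hG.isNearClique (v := r) (by omega)
  have low : ∀ {y z}, G.degree y = 5 → G.degree z = 5 → ¬ G.Adj y z := fun hy hz h => by
    have := hG.seven_le_degree_of_adj h (by omega)
    omega
  have npq := low hp hq
  have npr := low hp hr
  have nqp := low hq hp
  have nqr := low hq hr
  have hvp : G.Adj p v := ((hv p).2 (by simp)).symm
  have hvq : G.Adj q v := ((hv q).2 (by simp)).symm
  have hvr : G.Adj r v := ((hv r).2 (by simp)).symm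
  have nd' : ([v, b, c, d, e].Nodup ∧ [v, a, c, d, e].Nodup ∧ [v, a, b, d, e].Nodup) ∧
      [v, b, c, e].Nodup ∧ [v, a, c, d].Nodup := by
    simp only [List.nodup_cons, List.mem_cons, List.not_mem_nil, or_false, not_or,
      not_false_eq_true, and_true, List.nodup_nil] at nd ⊢
    simp only [nd, not_false_eq_true, and_self]
  obtain ⟨⟨ndp, ndq, ndr⟩, ndp', ndq'⟩ := nd'
  have hmr := adj_iff_mem_of_degree_eq_five hr ndr rfl (by simp [*])
  by_cases hpd : G.Adj p d
  · exact hG.false_of_degree_eight_of_misses nd hv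
      (adj_iff_mem_of_degree_eq_five hp ndp rfl (by simp [*]))
      (adj_iff_mem_of_degree_eq_five hq ndq rfl (by simp [*, hde hpd])) hmr np nq nr
  obtain ⟨m, ndm, hmp⟩ := exists_neighbor_list_of_degree_eq_five hp ndp' rfl (by simp [*])
  have hpm : G.Adj p m := (hmp m).2 (by simp)
  have hm : m ∉ [v, p, q, r, a, b, c, d, e] := by
    intro h
    simp only [List.mem_cons, List.not_mem_nil, or_false] at h
    rcases h with rfl | rfl | rfl | rfl | rfl | rfl | rfl | rfl | rfl <;>
      first | contradiction | exact hpm.ne rfl | simp at ndm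
  have ndm' : ([v, p, q, r, a, b, c, d, e] ++ [m]).Nodup :=
    nd.append (List.nodup_singleton m) (by simpa using hm)
  by_cases hqe : G.Adj q e
  · exact hG.false_of_degree_eight_of_misses_one ndm' hv hmp
      (adj_iff_mem_of_degree_eq_five hq ndq rfl (by simp [*])) hmr np nq nr
  obtain ⟨n, ndn, hmq⟩ := exists_neighbor_list_of_degree_eq_five hq ndq' rfl (by simp [*])
  by_cases hmn : m = n
  · subst hmn
    exact hG.false_of_degree_eight_of_misses_two_of_eq ndm' hv hmp hmq hmr np nq nr
  have hqn : G.Adj q n := (hmq n).2 (by simp)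
  have hn : n ∉ [v, p, q, r, a, b, c, d, e] ++ [m] := by
    intro h
    simp only [List.cons_append, List.nil_append, List.mem_cons, List.not_mem_nil, or_false] at h
    rcases h with rfl | rfl | rfl | rfl | rfl | rfl | rfl | rfl | rfl | rfl <;>
      first | contradiction | exact hqn.ne rfl | simp at ndn
  exact hG.false_of_degree_eight_of_misses_two
    (ndm'.append (List.nodup_singleton n) (by simpa using hn)) hv hmp hmq hmr np nq nr

lemma false_of_degree_eight_of_three_misses (hG : G.IsTuzaTight) {v p q r a b c d e : V}
    (hp : G.degree p = 5) (hq : G.degree q = 5) (hr : G.degree r = 5)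
    (nd : [v, p, q, r, a, b, c, d, e].Nodup)
    (hv : ∀ w, G.Adj v w ↔ w ∈ [p, q, r, a, b, c, d, e])
    (npa : ¬ G.Adj p a) (nqb : ¬ G.Adj q b) (nrc : ¬ G.Adj r c)
    (hpb : G.Adj p b) (hpc : G.Adj p c) (hqa : G.Adj q a) (hqc : G.Adj q c)
    (hra : G.Adj r a) (hrb : G.Adj r b)
    (hqd : G.Adj q d) (hrd : G.Adj r d) (hpe : G.Adj p e) (hre : G.Adj r e) : False := by
  by_cases hde : G.Adj p d → G.Adj q e
  · exact hG.false_of_degree_eight_of_three_misses_aux hp hq hr nd hv npa nqb nrc hpb hpc hqa hqc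
      hra hrb hqd hrd hpe hre hde
  · rw [Classical.not_imp] at hde
    have hperm : [p, q, r, a, b, c, d, e].Perm [q, p, r, b, a, c, e, d] :=
      (List.Perm.swap q p [r]).append ((List.Perm.swap b a [c]).append (List.Perm.swap e d []))
    exact hG.false_of_degree_eight_of_three_misses_aux hq hp hr ((hperm.cons v).nodup_iff.1 nd)
      (fun w => (hv w).trans hperm.mem_iff) nqb npa nrc hqa hqc hpb hpc hrb hra hpe hre hqd hrd
      fun h => absurd h hde.2

/-- Plain and primed letters stand for adjacency of the three vertices to `d` and to `e`. At most
one vertex misses `d`, at most one misses `e`, and none misses both; ordering them as misser of `d`,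
misser of `e`, the third meets one of the six hypotheses. -/
lemma false_of_at_most_one_miss {p q r p' q' r' : Prop} (h₁ : q → r → p' → r' → False)
    (h₂ : p → r → q' → r' → False) (h₃ : r → q → p' → q' → False) (h₄ : q → p → r' → p' → False)
    (h₅ : r → p → q' → p' → False) (h₆ : p → q → r' → q' → False) (hp : p ∨ p') (hq : q ∨ q')
    (hr : r ∨ r') (d₁ : q ∨ r) (d₂ : p ∨ r) (d₃ : p ∨ q) (e₁ : q' ∨ r') (e₂ : p' ∨ r')
    (e₃ : p' ∨ q') : False := by
  grind

/-- A vertex of degree eight has at most two neighbours of degree five. -/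
lemma false_of_degree_eq_eight (hG : G.IsTuzaTight) {v p q r : V} (hv : G.degree v = 8)
    (hp : G.degree p = 5) (hq : G.degree q = 5) (hr : G.degree r = 5) (hnd : [p, q, r].Nodup)
    (hvl : ∀ w ∈ [p, q, r], G.Adj v w) : False := by
  obtain ⟨X, nd, hX, hm⟩ := exists_neighbor_list_append v _ hnd hvl
  simp only [List.length_cons, List.length_nil] at hX
  have hX5 : X.length = 5 := by omega
  have nd' := nd
  simp only [List.nodup_cons, List.cons_append, List.nil_append, List.mem_cons, not_or] at nd'
  obtain ⟨⟨-, -, -, hvX⟩, ⟨hpq, hpr, hpX⟩, ⟨hqr, hqX⟩, hrX, hXnd⟩ := nd'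
  have low : ∀ {y z}, G.degree y = 5 → G.degree z = 5 → ¬ G.Adj y z := fun hy hz h => by
    have := hG.seven_le_degree_of_adj h (by omega)
    omega
  have hvX : ∀ x ∈ X, G.Adj v x := fun x hx => (hm x).2 (by simp [hx])
  have hvp : G.Adj v p := hvl p (by simp)
  have hvq : G.Adj v q := hvl q (by simp)
  have hvr : G.Adj v r := hvl r (by simp)
  -- Applied in three orders: every vertex of `X` is missed by at most one of `p, q, r`. Each of
  -- these misses some vertex, as `v` and `X` are six vertices, hence the missed `a, b, c` are
  -- distinct.
  have pair : ∀ {p q r : V}, G.degree p = 5 → G.degree q = 5 → G.degree r = 5 →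
      [p, q, r].Nodup → (∀ w ∈ [p, q, r], G.Adj v w) → p ∉ X → q ∉ X → r ∉ X →
      ∀ x ∈ X, G.Adj q x ∨ G.Adj r x := by
    intro p q r hp hq hr hnd hvl hpX hqX hrX x hx
    have h := hG.adj_or_adj_of_degree_eq_eight hv hp hq hr
      (hnd.append (List.nodup_singleton x) (by
        simp only [List.disjoint_singleton, List.mem_cons, List.not_mem_nil, or_false, not_or]
        exact ⟨fun h => hpX (h ▸ hx), fun h => hqX (h ▸ hx), fun h => hrX (h ▸ hx)⟩))
      (by
        intro w hw
        have hw : w ∈ [p, q, r] ++ [x] := hw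
        rcases List.mem_append.1 hw with hw | hw
        · exact hvl w hw
        · rw [List.mem_singleton.1 hw]
          exact hvX x hx)
    exact h.imp Adj.symm Adj.symm
  have hqrX := pair hp hq hr hnd hvl hpX hqX hrX
  have hprX := pair hq hp hr (by simp [*, Ne.symm]) (by simp [*]) hqX hpX hrX
  have hpqX := pair hr hp hq (by simp [*, Ne.symm]) (by simp [*]) hrX hpX hqX
  have mem : ∀ u, G.degree u = 5 → ∀ w, G.Adj u w → G.Adj v w → w ∈ X := by
    intro u hu w huw hvw
    have hne : ∀ {z}, G.degree z = 5 → w ≠ z := fun hz h => low hu hz (h ▸ huw)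
    simpa [hne hp, hne hq, hne hr] using (hm w).1 hvw
  have miss : ∀ u, G.degree u = 5 → G.Adj v u → ∃ a ∈ X, ¬ G.Adj u a := by
    intro u hu hvu
    by_contra! hcon
    obtain ⟨l, -, hl, -⟩ := exists_neighbor_list_append u (v :: X)
      (List.nodup_cons.2 ⟨fun h => (hvX v h).ne rfl, hXnd⟩) (by
        intro w hw
        rcases List.mem_cons.1 hw with rfl | hw
        · exact hvu.symm
        · exact hcon w hw)
    simp only [List.length_cons] at hl
    omega
  have two : ∀ u, G.degree u = 5 → G.Adj v u → ∀ a ∈ X, ∀ b ∈ X, ∀ c ∈ X, a ≠ b → a ≠ c →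
      b ≠ c → ¬ G.Adj u a → G.Adj u b ∨ G.Adj u c := by
    intro u hu hvu a ha b hb c hc hab hac hbc nua
    by_contra! hcon
    have h := hG.three_le_length_of_common hvu.symm hu (l := ((X.erase a).erase b).erase c) (by
      intro w huw hvw
      have hne : ∀ {z}, ¬ G.Adj u z → w ≠ z := fun hz h => hz (h ▸ huw)
      rw [List.mem_erase_of_ne (hne hcon.2), List.mem_erase_of_ne (hne hcon.1),
        List.mem_erase_of_ne (hne nua)]
      exact mem u hu w huw hvw)
    have hb' := (List.mem_erase_of_ne hab.symm).2 hb
    rw [List.length_erase_of_mem ((List.mem_erase_of_ne hbc.symm).2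
      ((List.mem_erase_of_ne hac.symm).2 hc)), List.length_erase_of_mem hb',
      List.length_erase_of_mem ha] at h
    omega
  obtain ⟨a, ha, npa⟩ := miss p hp hvp
  obtain ⟨b, hb, nqb⟩ := miss q hq hvq
  obtain ⟨c, hc, nrc⟩ := miss r hr hvr
  have hqa := (hpqX a ha).resolve_left npa
  have hra := (hprX a ha).resolve_left npa
  have hpb := (hpqX b hb).resolve_right nqb
  have hrb := (hqrX b hb).resolve_left nqb
  have hpc := (hprX c hc).resolve_right nrc
  have hqc := (hqrX c hc).resolve_right nrc
  have hab : a ≠ b := fun h => nqb (h ▸ hqa)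
  have hac : a ≠ c := fun h => nrc (h ▸ hra)
  have hbc : b ≠ c := fun h => nrc (h ▸ hrb)
  obtain ⟨l₀, h₀, h₁⟩ := List.Nodup.subperm (l₁ := [a, b, c]) (l₂ := X) (by simp [*])
    (by simp [List.subset_def, *])
  obtain ⟨l, h₂⟩ := h₁.exists_perm_append
  have hl : X.Perm ([a, b, c] ++ l) := h₂.trans (h₀.append_right l)
  have hl2 := hl.length_eq
  simp only [List.length_append, List.length_cons, List.length_nil] at hl2
  obtain ⟨d, e, rfl⟩ := List.length_eq_two.1 (by omega : l.length = 2)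
  have hd : d ∈ X := hl.mem_iff.2 (by simp)
  have he : e ∈ X := hl.mem_iff.2 (by simp)
  obtain ⟨⟨-, -, had, hae⟩, ⟨-, hbd, hbe⟩, ⟨hcd, hce⟩, hde⟩ :
      (a ≠ b ∧ a ≠ c ∧ a ≠ d ∧ a ≠ e) ∧ (b ≠ c ∧ b ≠ d ∧ b ≠ e) ∧ (c ≠ d ∧ c ≠ e) ∧ d ≠ e := by
    simpa using hl.nodup_iff.1 hXnd
  have base : ∀ {P Q R A B C : V}, [p, q, r].Perm [P, Q, R] → [a, b, c].Perm [A, B, C] →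
      [v, P, Q, R, A, B, C, d, e].Nodup ∧ ∀ w, G.Adj v w ↔ w ∈ [P, Q, R, A, B, C, d, e] := by
    intro P Q R A B C h1 h2
    have h3 : ([p, q, r] ++ X).Perm [P, Q, R, A, B, C, d, e] :=
      h1.append (hl.trans (h2.append_right [d, e]))
    exact ⟨(h3.cons v).nodup_iff.1 nd, fun w => (hm w).trans h3.mem_iff⟩
  have rev : ∀ x y z : V, [x, y, z].Perm [z, y, x] := fun x y z =>
    (List.Perm.swap y x [z]).trans (List.perm_append_comm (l₁ := [y, x]) (l₂ := [z]))
  have c1 := base (.refl _) (.refl _)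
  have c2 := base (.swap q p [r]) (.swap b a [c])
  have c3 := base ((List.Perm.swap r q []).cons p) ((List.Perm.swap c b []).cons a)
  have c4 := base (rev p q r) (rev a b c)
  have c5 := base (List.perm_append_comm (l₁ := [p]) (l₂ := [q, r]))
    (List.perm_append_comm (l₁ := [a]) (l₂ := [b, c]))
  have c6 := base (List.perm_append_comm (l₁ := [p, q]) (l₂ := [r]))
    (List.perm_append_comm (l₁ := [a, b]) (l₂ := [c]))
  -- The six orders of `p, q, r`, with the missed vertices `a, b, c` permuted alongside.
  have k1 := hG.false_of_degree_eight_of_three_misses hp hq hr c1.1 c1.2 npa nqb nrc hpb hpc hqa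
    hqc hra hrb
  have k2 := hG.false_of_degree_eight_of_three_misses hq hp hr c2.1 c2.2 nqb npa nrc hqa hqc hpb
    hpc hrb hra
  have k3 := hG.false_of_degree_eight_of_three_misses hp hr hq c3.1 c3.2 npa nrc nqb hpc hpb hra
    hrb hqa hqc
  have k4 := hG.false_of_degree_eight_of_three_misses hr hq hp c4.1 c4.2 nrc nqb npa hrb hra hqc
    hqa hpc hpb
  have k5 := hG.false_of_degree_eight_of_three_misses hq hr hp c5.1 c5.2 nqb nrc npa hqc hqa hrb
    hra hpb hpc
  have k6 := hG.false_of_degree_eight_of_three_misses hr hp hq c6.1 c6.2 nrc npa nqb hra hrb hpc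
    hpb hqc hqa
  have tp := two p hp hvp a ha d hd e he had hae hde npa
  have tq := two q hq hvq b hb d hd e he hbd hbe hde nqb
  have tr := two r hr hvr c hc d hd e he hcd hce hde nrc
  have d1 := hqrX d hd
  have d2 := hprX d hd
  have d3 := hpqX d hd
  have e1 := hqrX e he
  have e2 := hprX e he
  have e3 := hpqX e he
  exact false_of_at_most_one_miss k1 k2 k3 k4 k5 k6 tp tq tr d1 d2 d3 e1 e2 e3

end IsTuzaTight

end SimpleGraph

/-! ### Discharging -/

namespace SimpleGraph

variable {V : Type*} {G : SimpleGraph V}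

section Discharging

variable [Fintype V] [DecidableRel G.Adj]

/-- The neighbours of degree at most six. -/
def lowNeighbors (G : SimpleGraph V) [DecidableRel G.Adj] (v : V) : Finset V :=
  (G.neighborFinset v).filter fun u => G.degree u ≤ 6

lemma mem_lowNeighbors {u v : V} : u ∈ G.lowNeighbors v ↔ G.Adj v u ∧ G.degree u ≤ 6 := by
  simp [lowNeighbors]

/-- Five times the charge that a vertex `v` sends to a neighbour `u` of degree at most six. -/
def charge (G : SimpleGraph V) [DecidableRel G.Adj] (v u : V) : ℕ :=
  if G.Adj v u ∧ G.degree u ≤ 6 ∧ 8 ≤ G.degree v then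
    -- After scaling by five, a degree-five vertex needs 10 and a degree-six vertex 5, so 2 or 1
    -- from each neighbour suffices. Vertices with few low neighbours can afford 5 each.
    if (G.lowNeighbors v).card + 7 ≤ G.degree v then 5 else if G.degree u = 5 then 2 else 1
  else 0

variable [DecidableEq V]

namespace IsTuzaTight

/-- The low neighbours form an independent set whose neighbours are not low, so the Hall-type
inequality puts more than that many high vertices in `N(v)`. -/
lemma two_mul_card_lowNeighbors_lt (hG : G.IsTuzaTight) {v : V}
    (hv : (G.lowNeighbors v).Nonempty) : 2 * (G.lowNeighbors v).card < G.degree v := by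
  have hlow : ∀ u ∈ G.lowNeighbors v, ∀ w, G.Adj u w → 7 ≤ G.degree w := fun u hu w huw =>
    hG.seven_le_degree_of_adj huw (mem_lowNeighbors.1 hu).2
  have h := hG.card_lt_of_independent v (G.lowNeighbors v) hv
    (fun a ha => (mem_lowNeighbors.1 ha).1) fun a ha b hb hab => by
      have h1 := hlow a ha b hab
      have h2 := (mem_lowNeighbors.1 hb).2
      omega
  have hsub : ((G.lowNeighbors v).biUnion fun a => G.neighborFinset v ∩ G.neighborFinset a) ⊆
      G.neighborFinset v \ G.lowNeighbors v := by
    intro w hw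
    simp only [Finset.mem_biUnion, Finset.mem_inter, mem_neighborFinset] at hw
    obtain ⟨a, ha, hvw, haw⟩ := hw
    have := hlow a ha w haw
    simp only [Finset.mem_sdiff, mem_neighborFinset, mem_lowNeighbors, not_and]
    exact ⟨hvw, fun _ => by omega⟩
  have h1 := Finset.card_le_card hsub
  rw [Finset.card_sdiff_of_subset
    (show G.lowNeighbors v ⊆ G.neighborFinset v from Finset.filter_subset _ _), card_neighborFinset_eq_degree] at h1
  omega

lemma sum_charge_out_le (hG : G.IsTuzaTight) {v : V} (hv : 7 ≤ G.degree v) :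
    35 + ∑ u, G.charge v u ≤ 5 * G.degree v := by
  by_cases h7 : G.degree v = 7
  · have : ∀ u, G.charge v u = 0 := fun u => if_neg (by omega)
    simp [this, h7]
  have h8 : 8 ≤ G.degree v := by omega
  have hsum : ∑ u, G.charge v u = ∑ u ∈ G.lowNeighbors v,
      if (G.lowNeighbors v).card + 7 ≤ G.degree v then 5 else if G.degree u = 5 then 2 else 1 := by
    have hfilter : G.lowNeighbors v =
        Finset.univ.filter fun u => G.Adj v u ∧ G.degree u ≤ 6 ∧ 8 ≤ G.degree v := by
      ext u
      simp [mem_lowNeighbors, h8]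
    conv_rhs => rw [Finset.sum_congr hfilter fun _ _ => rfl, Finset.sum_filter]
    rfl
  rw [hsum]
  by_cases hl : (G.lowNeighbors v).card + 7 ≤ G.degree v
  · simp only [hl, if_true, Finset.sum_const, smul_eq_mul]
    omega
  simp only [hl, if_false]
  have hne : (G.lowNeighbors v).Nonempty := by
    rw [← Finset.card_pos]
    omega
  have h2 := hG.two_mul_card_lowNeighbors_lt hne
  have hle : ∑ u ∈ G.lowNeighbors v, (if G.degree u = 5 then 2 else 1) ≤
      (G.lowNeighbors v).card * 2 :=
    Finset.sum_le_card_nsmul _ _ _ fun u _ => by split <;> omega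
  -- With `l` low neighbours, `2l ≤ d - 1` bounds the outflow by `d - 1 ≤ 5(d - 7)` once `d ≥ 9`.
  -- For `d = 8` the budget is 5, exceeded only by three neighbours of degree five.
  by_cases h3 : G.degree v = 8 ∧ (G.lowNeighbors v).card = 3
  · obtain ⟨p, q, r, hpq, hpr, hqr, hs⟩ := Finset.card_eq_three.1 h3.2
    have hadj : ∀ w ∈ [p, q, r], G.Adj v w := by
      intro w hw
      have : w ∈ G.lowNeighbors v := by rw [hs]; simpa using hw
      exact (mem_lowNeighbors.1 this).1
    have := fun hp hq hr => hG.false_of_degree_eq_eight h3.1 hp hq hr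
      (by simp [hpq, hpr, hqr]) hadj
    rw [hs, Finset.sum_insert (by simp [hpq, hpr]), Finset.sum_pair hqr]
    split_ifs <;> first | omega | (exfalso; apply this <;> assumption)
  · omega

/-- If all neighbours have degree at least eight, the small gifts suffice. A neighbour of degree
seven sends nothing, but forces `u` to have degree five and three neighbours that send 5 each. -/
lemma le_sum_charge_in (hG : G.IsTuzaTight) {u : V} (h5 : 5 ≤ G.degree u)
    (h6 : G.degree u ≤ 6) : 35 ≤ 5 * G.degree u + ∑ v, G.charge v u := by
  have hnbr : ∀ w ∈ G.neighborFinset u, 7 ≤ G.degree w := fun w hw =>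
    hG.seven_le_degree_of_adj ((G.mem_neighborFinset u w).1 hw) h6
  have hcharge : ∀ w ∈ G.neighborFinset u, 8 ≤ G.degree w →
      (if G.degree u = 5 then 2 else 1) ≤ G.charge w u := by
    intro w hw hw8
    have hc : G.charge w u = if (G.lowNeighbors w).card + 7 ≤ G.degree w then 5
        else if G.degree u = 5 then 2 else 1 :=
      if_pos ⟨((G.mem_neighborFinset u w).1 hw).symm, h6, hw8⟩
    rw [hc]
    split_ifs <;> omega
  have hsum : ∑ w ∈ G.neighborFinset u, G.charge w u ≤ ∑ v, G.charge v u :=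
    Finset.sum_le_sum_of_subset (Finset.subset_univ _)
  by_cases hall : ∀ w ∈ G.neighborFinset u, 8 ≤ G.degree w
  · have h := Finset.card_nsmul_le_sum (G.neighborFinset u) (fun w => G.charge w u) _
      fun w hw => hcharge w hw (hall w hw)
    rw [card_neighborFinset_eq_degree, smul_eq_mul] at h
    obtain hd | hd : G.degree u = 5 ∨ G.degree u = 6 := by omega
    · simp only [hd, if_true] at h ⊢
      omega
    · simp only [hd] at h ⊢
      simp at h
      omega
  · push Not at hall
    obtain ⟨v, hv, hv8⟩ := hall
    have huv := (G.mem_neighborFinset u v).1 hv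
    have hv7 : G.degree v = 7 := by
      have := hnbr v hv
      omega
    have hu5 : G.degree u = 5 := by
      by_contra hne
      exact hG.degree_ne_seven_of_adj huv (by omega) hv7
    obtain ⟨W, hW, hWu⟩ := hG.exists_three_of_adj_five_seven huv hu5 hv7
    have h := Finset.card_nsmul_le_sum W (fun w => G.charge w u) 5 fun w hw => by
      obtain ⟨huw, hl⟩ := hWu w hw
      have hlow : 0 < (G.lowNeighbors w).card :=
        Finset.card_pos.2 ⟨u, mem_lowNeighbors.2 ⟨huw.symm, h6⟩⟩
      change (G.lowNeighbors w).card + 7 ≤ G.degree w at hl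
      rw [charge, if_pos ⟨huw.symm, h6, by omega⟩, if_pos hl]
    have h' : ∑ w ∈ W, G.charge w u ≤ ∑ v, G.charge v u :=
      Finset.sum_le_sum_of_subset (Finset.subset_univ _)
    rw [hW, smul_eq_mul] at h
    omega

theorem seven_mul_card_le_sum_degree (hG : G.IsTuzaTight) :
    7 * (Finset.univ.filter fun v => 0 < G.degree v).card ≤ ∑ v, G.degree v := by
  have hv : ∀ v, (if 0 < G.degree v then 35 else 0) + ∑ u, G.charge v u ≤
      5 * G.degree v + ∑ w, G.charge w v := by
    intro v
    by_cases h0 : 0 < G.degree v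
    · rw [if_pos h0]
      by_cases h7 : 7 ≤ G.degree v
      · have := hG.sum_charge_out_le h7
        omega
      · have h1 := hG.le_sum_charge_in (hG.five_le_degree h0) (by omega)
        have h2 : ∀ u, G.charge v u = 0 := fun u => if_neg (by omega)
        simpa [h2] using h1
    · have h2 : ∀ u, G.charge v u = 0 := fun u => if_neg (by omega)
      simp [h0, h2]
  have h := Finset.sum_le_sum fun v (_ : v ∈ Finset.univ) => hv v
  rw [Finset.sum_add_distrib, Finset.sum_add_distrib, Finset.sum_comm (f := fun v u => G.charge v u),
    add_le_add_iff_right, ← Finset.mul_sum, ← Finset.sum_filter, Finset.sum_const,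
    smul_eq_mul] at h
  omega

end IsTuzaTight

end Discharging

/-! ### Induction on the number of edges -/

/-- Every nonempty subgraph, without isolated vertices, has average degree less than seven. -/
def IsSparse (G : SimpleGraph V) : Prop :=
  ∀ H ≤ G, H.support.Nonempty → 2 * H.edgeSet.ncard < 7 * H.support.ncard

lemma IsSparse.mono {H : SimpleGraph V} (hG : G.IsSparse) (h : H ≤ G) : H.IsSparse :=
  fun K hK => hG K (hK.trans h)

lemma IsTuzaTight.eq_bot_of_isSparse [Finite V] (hG : G.IsTuzaTight) (hs : G.IsSparse) :
    G = ⊥ := by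
  classical
  have := Fintype.ofFinite V
  by_contra hne
  have hsupp : G.support.Nonempty := by
    obtain ⟨a, b, hab⟩ := ne_bot_iff_exists_adj.1 hne
    exact ⟨a, b, hab⟩
  have h1 := hs G le_rfl hsupp
  have h2 := hG.seven_mul_card_le_sum_degree
  have h3 : G.support = ((Finset.univ.filter fun v => 0 < G.degree v : Finset V) : Set V) := by
    ext v
    simp [mem_support, degree_pos_iff_exists_adj]
  rw [h3, Set.ncard_coe_finset, ← coe_edgeFinset, Set.ncard_coe_finset] at h1
  rw [sum_degrees_eq_twice_card_edges] at h2
  omega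

lemma not_subsingleton_of_isNClique {t : Finset V} (ht : G.IsNClique 3 t) :
    ¬ (t : Set V).Subsingleton := by
  intro h
  have h1 := Finset.card_le_one_iff_subsingleton_coe.2 ((Set.subsingleton_coe _).2 h)
  have h2 := ht.card_eq
  omega

/-- A triangle cover and a triangle packing witnessing Tuza's inequality. -/
theorem IsSparse.exists_cover_packing [Finite V] (hG : G.IsSparse) :
    ∃ (Y : Finset (Sym2 V)) (T : Finset (Finset V)), G.IsTriangleCover Y ∧
      G.IsTrianglePacking T ∧ Y.card ≤ 2 * T.card := by
  classical
  induction hn : G.edgeSet.ncard using Nat.strong_induction_on generalizing G with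
  | _ n ih =>
    have step : ∀ Y : Set (Sym2 V), G.deleteEdges Y ≠ G →
        ∃ (Y' : Finset (Sym2 V)) (T : Finset (Finset V)), (G.deleteEdges Y).IsTriangleCover Y' ∧
          (G.deleteEdges Y).IsTrianglePacking T ∧ Y'.card ≤ 2 * T.card := by
      intro Y hY
      refine ih _ ?_ (hG.mono (deleteEdges_le Y)) rfl
      rw [← hn]
      exact Set.ncard_lt_ncard (edgeSet_ssubset_edgeSet.2 (lt_of_le_of_ne (deleteEdges_le Y) hY))
        (Set.toFinite _)
    have mono : ∀ {Y : Set (Sym2 V)} {s : Finset V}, (G.deleteEdges Y).IsNClique 3 s →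
        G.IsNClique 3 s := fun h => h.mono (deleteEdges_le _)
    by_cases hedge : ∃ a b, G.Adj a b ∧ ∀ c, G.Adj a c → ¬ G.Adj b c
    · obtain ⟨a, b, hab, hc⟩ := hedge
      obtain ⟨Y, T, ⟨hYsub, hYfree⟩, ⟨hT, hTpair⟩, hcard⟩ := step {s(a, b)} (by
        intro h
        rw [← h] at hab
        simp at hab)
      refine ⟨Y, T, ⟨hYsub.trans (edgeSet_mono (deleteEdges_le _)), ?_⟩,
        ⟨fun t ht => mono (hT t ht), hTpair⟩, hcard⟩
      intro s hs
      refine hYfree s ⟨fun x hx y hy hxy => ?_, hs.card_eq⟩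
      have hxy' := hs.isClique hx hy hxy
      rw [deleteEdges_adj] at hxy' ⊢
      refine ⟨?_, hxy'.2⟩
      rw [deleteEdges_adj]
      refine ⟨hxy'.1, fun hmem => ?_⟩
      have hs' := mono hs
      obtain ⟨z, hz, hzx, hzy⟩ : ∃ z ∈ s, z ≠ x ∧ z ≠ y := by
        by_contra! hcon
        have hsub : s ⊆ {x, y} := by
          intro z hz
          by_cases hzx : z = x
          · simp [hzx]
          · simp [hcon z hz hzx]
        have := Finset.card_le_card hsub
        have := hs.card_eq
        have := Finset.card_le_two (a := x) (b := y)
        omega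
      have hxz := hs'.isClique hx hz hzx.symm
      have hyz := hs'.isClique hy hz hzy.symm
      rcases Sym2.eq_iff.1 (Set.mem_singleton_iff.1 hmem) with ⟨rfl, rfl⟩ | ⟨rfl, rfl⟩
      · exact hc z hxz hyz
      · exact hc z hyz hxz
    push Not at hedge
    by_cases hirr : G.IsTuzaIrreducible
    · obtain rfl := IsTuzaTight.eq_bot_of_isSparse ⟨hirr, hedge⟩ hG
      exact ⟨∅, ∅, ⟨by simp, (cliqueFree_bot (by omega)).anti (deleteEdges_le _)⟩,
        ⟨by simp, by simp⟩, by simp⟩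
    · simp only [IsTuzaIrreducible, not_forall, not_exists, not_and, not_not] at hirr
      obtain ⟨T, Y, ⟨t₀, ht₀⟩, ⟨hT, hTpair⟩, hcard, hdisj⟩ := hirr
      -- Deleting `Y` removes some edge, for otherwise `t₀` would survive and meet itself in an
      -- edge.
      obtain ⟨Y', T', ⟨hYsub', hYfree'⟩, ⟨hT', hTpair'⟩, hcard'⟩ := step Y (fun h =>
        not_subsingleton_of_isNClique (hT t₀ ht₀)
          (by simpa using hdisj t₀ ht₀ t₀ (by rw [h]; exact hT t₀ ht₀)))
      have hTT : Disjoint T T' := Finset.disjoint_left.2 fun t ht ht' =>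
        not_subsingleton_of_isNClique (hT t ht) (by simpa using hdisj t ht t (hT' t ht'))
      -- The set `Y` of a reduction may contain pairs that are not edges of `G`; a cover may not.
      refine ⟨(Y ∪ Y').filter (· ∈ G.edgeSet), T ∪ T', ⟨?_, ?_⟩, ⟨?_, ?_⟩, ?_⟩
      · intro e he
        exact (Finset.mem_filter.1 he).2
      · refine hYfree'.anti fun x y hxy => ?_
        rw [deleteEdges_adj] at hxy ⊢
        rw [deleteEdges_adj]
        obtain ⟨hadj, hmem⟩ := hxy
        simp only [Finset.coe_filter, Finset.mem_union, mem_edgeSet, Set.mem_ofPred_eq, hadj,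
          and_true, not_or] at hmem
        exact ⟨⟨hadj, hmem.1⟩, hmem.2⟩
      · intro t ht
        rcases Finset.mem_union.1 ht with ht | ht
        · exact hT t ht
        · exact mono (hT' t ht)
      · intro s hs t ht hst
        rw [Finset.coe_union] at hs ht
        rcases hs with hs | hs <;> rcases ht with ht | ht
        · exact hTpair hs ht hst
        · have := hdisj s hs t (hT' t ht)
          rwa [Set.inter_comm]
        · exact hdisj t ht s (hT' s hs)
        · exact hTpair' hs ht hst
      · have h1 := Finset.card_filter_le (Y ∪ Y') (· ∈ G.edgeSet)
        have h2 := Finset.card_union_le Y Y'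
        rw [Finset.card_union_of_disjoint hTT]
        omega

lemma isSparse_of_mad_lt [Finite V] (hG : G.mad < 7) : G.IsSparse := by
  intro H hH hne
  let S : G.Subgraph :=
    { verts := H.support
      Adj := H.Adj
      adj_sub := fun h => hH h
      edge_vert := fun h => ⟨_, h⟩
      symm := H.symm }
  -- A finite graph has finitely many subgraphs; boundedness is what makes the real `sSup` an upper
  -- bound.
  have hbdd : BddAbove {d : ℝ | ∃ H : G.Subgraph, H.verts.Nonempty ∧
      d = 2 * (H.edgeSet.ncard : ℝ) / (H.verts.ncard : ℝ)} := by
    refine (Set.Finite.subset (Set.finite_range fun H : G.Subgraph =>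
      2 * (H.edgeSet.ncard : ℝ) / (H.verts.ncard : ℝ)) ?_).bddAbove
    rintro _ ⟨H, -, rfl⟩
    exact ⟨H, rfl⟩
  have hle : 2 * (S.edgeSet.ncard : ℝ) / (S.verts.ncard : ℝ) ≤ G.mad :=
    le_csSup hbdd ⟨S, hne, rfl⟩
  have hedge : S.edgeSet = H.edgeSet := by
    ext e
    induction e with
    | _ a b => rfl
  have hpos : (0 : ℝ) < H.support.ncard := by
    exact_mod_cast (Set.ncard_pos (Set.toFinite _)).2 hne
  have hlt := hle.trans_lt hG
  rw [hedge, div_lt_iff₀ (by exact hpos)] at hlt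
  exact_mod_cast hlt

end SimpleGraph

theorem theorem1 {V : Type*} [Finite V] (G : SimpleGraph V) (hG : G.mad < 7) :
    G.triangleCoverNumber ≤ 2 * G.trianglePackingNumber := by
  obtain ⟨Y, T, hY, hT, hcard⟩ := (SimpleGraph.isSparse_of_mad_lt hG).exists_cover_packing
  have h1 : G.triangleCoverNumber ≤ Y.card := Nat.sInf_le ⟨Y, hY, rfl⟩
  have h2 : T.card ≤ G.trianglePackingNumber := by
    refine le_csSup ?_ ⟨T, hT, rfl⟩
    refine (Set.Finite.subset (Set.finite_range fun T : Finset (Finset V) => T.card) ?_).bddAbove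
    rintro _ ⟨T, -, rfl⟩
    exact ⟨T, rfl⟩
  omega
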